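/- Let $\gamma<0$ and $g(x)=x^\gamma$ for $x\ge 1$. For $A\ge 1$ let $\mathcal D=\{(x,y)\in\mathbb R^2: x>A,\ |y|<g(x)\}$. Let $\alpha$ be a random angle such that $\mathbf P[|\alpha|<c]=1$ for some constant $c\in(0,\pi/2)$, $\mathbf P[\alpha\ge x]=\mathbf P[\alpha\le -x]$ for all $x\in\mathbb R$, and $\alpha$ is non-degenerate (not almost surely constant); let $\alpha_0,\alpha_1,\alpha_2,\dots$ be i.i.d. copies of $\alpha$. The collisions process $\xi_n=(\xi_n^{(1)},\xi_n^{(2)})$, with values in $\partial\mathcal D\cup\{\infty\}$, is defined from a starting point $\xi_0\in\partial\mathcal D$ as follows. The state $\infty$ is absorbing. If $\xi_k\neq\infty$, consider the ray from $\xi_k$ that makes the angle $\alpha_k$ with the interior normal to $\partial\mathcal D$ at $\xi_k$, positive angles being to the right (towards increasing $x$) and negative angles to the left of the normal. If this ray does not meet $\partial\mathcal D\setminus\{\xi_k\}$, then $\xi_{k+1}=\infty$. Otherwise let $(x_k,y_k)$ be the first point where it does; if $x_k=A$ then $\xi_{k+1}=(2A,g(2A))$, and else $\xi_{k+1}=(x_k,y_k)$.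 Then there is $A_0$, depending only on $\gamma$ and the distribution of $\alpha$, such that for all $A\ge 1$ with $A>A_0$ and all $\xi_0\in\partial\mathcal D$ with $\xi_0^{(1)}>2A$, almost surely $\xi_n\ne\infty$ for all $n$, and the following hold. (i) If $\gamma>-\mathbf E[\tan^2\alpha]$, then for every $\varepsilon>0$, almost surely, for all but finitely many $n$, $$ n^{\frac1{2(1-\gamma)}}(\log n)^{-\frac1{2(1-\gamma)}-\varepsilon}\ \le\ \max_{0\le m\le n}\xi_m^{(1)}\ \le\ n^{\frac1{2(1-\gamma)}}(\log n)^{\frac1{2(1-\gamma)}+\varepsilon}. $$ (ii) If $\gamma<-\mathbf E[\tan^2\alpha]$, then with $\rho(\gamma)=\dfrac{\mathbf E[\tan^2\alpha]}{(1-2\gamma)\mathbf E[\tan^2\alpha]-\gamma}$, for every $\varepsilon>0$, almost surely, for all but finitely many $n$, $$ n^{\rho(\gamma)}(\log n)^{-2\rho(\gamma)-\varepsilon}\ \le\ \max_{0\le m\le n}\xi_m^{(1)}\ \le\ n^{\rho(\gamma)}(\log n)^{2\rho(\gamma)+\varepsilon}. $$ -/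

import Mathlib

open MeasureTheory ProbabilityTheory Filter Topology

namespace StochasticBilliard

noncomputable section

/-- The tube `{(x, y) : x > A, |y| < g x}` in the plane. -/
def tube (g : ℝ → ℝ) (A : ℝ) : Set (ℝ × ℝ) :=
  {p | A < p.1 ∧ |p.2| < g p.1}

/-- The inward normal at a point `p` of the curved part of the boundary: the upper curve `y = g x` if
`p.2 > 0`, the lower curve `y = - g x` otherwise. Its length is `√(1 + g' ^ 2)`. -/
def inwardNormal (g : ℝ → ℝ) (p : ℝ × ℝ) : ℝ × ℝ :=
  (deriv g p.1, if 0 < p.2 then -1 else 1)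

/-- The tangent vector at a point `p` of the curved part of the boundary that points to the right
(increasing `x`), of the same length `√(1 + g' ^ 2)` as `inwardNormal g p`. -/
def rightTangent (g : ℝ → ℝ) (p : ℝ × ℝ) : ℝ × ℝ :=
  (1, if 0 < p.2 then deriv g p.1 else - deriv g p.1)

/-- A direction vector of the ray that leaves `p` at angle `a` to the inward normal; positive angles
are to the right of the normal (towards increasing `x`), negative angles to the left. The length of
the vector plays no role. -/
def rayDirection (g : ℝ → ℝ) (p : ℝ × ℝ) (a : ℝ) : ℝ × ℝ :=
  Real.cos a • inwardNormal g p + Real.sin a • rightTangent g p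

/-- The parameters `t > 0` at which the ray from `p` at angle `a` meets the boundary of the tube. -/
def hitTimes (g : ℝ → ℝ) (A : ℝ) (p : ℝ × ℝ) (a : ℝ) : Set ℝ :=
  {t | 0 < t ∧ p + t • rayDirection g p a ∈ frontier (tube g A)}

/-- The first point where the ray from `p` at angle `a` meets the boundary again (meaningful if the
ray meets the boundary at all). -/
def firstHit (g : ℝ → ℝ) (A : ℝ) (p : ℝ × ℝ) (a : ℝ) : ℝ × ℝ :=
  p + sInf (hitTimes g A p a) • rayDirection g p a

open Classical in
/-- One step of the collisions process from the boundary point `p` with reflection angle `a`. The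
value `none` is the absorbing state at infinity; a particle that hits the vertical part `x = A` of
the boundary is put at `(2 A, g (2 A))`. -/
def nextCollision (g : ℝ → ℝ) (A : ℝ) (p : ℝ × ℝ) (a : ℝ) : Option (ℝ × ℝ) :=
  if (hitTimes g A p a).Nonempty then
    if (firstHit g A p a).1 = A then some (2 * A, g (2 * A)) else some (firstHit g A p a)
  else none

/-- The collisions process started at `p` and driven by the sequence of reflection angles `a`. -/
def collisions (g : ℝ → ℝ) (A : ℝ) (p : ℝ × ℝ) (a : ℕ → ℝ) : ℕ → Option (ℝ × ℝ)
  | 0 => some p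
  | k + 1 => (collisions g A p a k).bind fun q => nextCollision g A q (a k)

/-- The horizontal coordinate of a state; the value at `none` is a dummy. -/
def horizontal : Option (ℝ × ℝ) → ℝ
  | some p => p.1
  | none => 0

/-- The running maximum over `0 ≤ m ≤ n` of the horizontal coordinate of the collisions process. -/
def runningMax (g : ℝ → ℝ) (A : ℝ) (p : ℝ × ℝ) (a : ℕ → ℝ) (n : ℕ) : ℝ :=
  (Finset.range (n + 1)).sup' Finset.nonempty_range_add_one
    fun m => horizontal (collisions g A p a m)

/-- The mean of the squared tangent of an angle with law `μ`. -/
def meanTanSq (μ : Measure ℝ) : ℝ := ∫ a, Real.tan a ^ 2 ∂μ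

/-- The exponent `ρ(γ)` belonging to the law `μ` of the reflection angle. -/
def rho (μ : Measure ℝ) (γ : ℝ) : ℝ :=
  meanTanSq μ / ((1 - 2 * γ) * meanTanSq μ - γ)

end

end StochasticBilliard

namespace StochasticBilliard

noncomputable section

/-! Far out the tube is nearly flat, so a flight from abscissa `x` moves the particle by a small
relative amount `z` of order `w = x ^ (γ - 1)`. With `T = tan a`, `z` solves a scalar fixed-point
equation, and expanding it uniformly in bounded `T` gives `z = 2wT + 2γw²(1 + 2T²) + O(w³)`. By
symmetry of the angle `E T = 0`, so with `m = E T²` the drift of `x ^ k` is `driftCoeff γ m k * x ^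
(k - 2 + 2γ)`, up to a relative error of order `w`.

The growth exponent is `1 / κ`, where `x ^ κ` is a suitable Lyapunov function. If `γ > -m`, take `κ
= 2(1 - γ)`: the power in the drift is then `x ^ 0` and the coefficient is positive, so the drift
tends to a positive constant. If `γ < -m`, take `κ = 1 / ρ`, the nonzero root of `driftCoeff γ m`.
Here `x ^ κ` is almost a martingale, and adding or subtracting a lower power `x ^ (κ - η)` makes its
drift nonpositive or bounded below by a positive constant (`hasDrift_of_driftCoeff_eq_zero`).

Such functions give both tails of the running maximum `M n`: `P(M n ≥ v) ≤ C n / v ^ κ`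
(`exists_upper_tail`) and `P(M n < v) ≤ C (v ^ κ + 1) / n` (`exists_lower_tail`). Borel–Cantelli
along powers of two, with monotonicity of `M` in between, turns them into almost sure bounds with
`log n` to the power `±(1 / κ + ε)`. -/

/-! ### One flight: the relative displacement as the root of a scalar equation -/

/-- Horizontal displacement per unit of vertical displacement along a ray with `tan a = T` that
leaves the upper curve at a point where the slope of the curve is `γ * w`. -/
def chordSlope (γ w T : ℝ) : ℝ := (T + γ * w) / (1 - γ * w * T)

/-- The function whose zero is the relative displacement `z` of the ray that goes from abscissa `x`
to abscissa `x * (1 + z)`, where `w = x ^ (γ - 1)`. -/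
def hitDefect (γ w T z : ℝ) : ℝ := z - w * chordSlope γ w T * (1 + (1 + z) ^ γ)

/-- Smallness of the scaled width `w = x ^ (γ - 1)` for angles with tangent bounded by `K`. -/
structure IsNarrow (γ K w : ℝ) : Prop where
  pos : 0 < w
  slope_le : |γ| * w ≤ 1
  slope_mul_le : |γ| * w * K ≤ 1 / 2
  disp_le : w * (2 * (K + 1)) * (1 + 2 ^ (-γ)) ≤ 1 / 2
  lip_le : w * (2 * (K + 1)) * (|γ| * 2 ^ (1 - γ)) ≤ 1 / 2

/-- Each bound concerns a continuous function of `w` vanishing at `0`. The slope bounds give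
`|chordSlope| ≤ 2 * (K + 1)`; `disp_le` and `lip_le` make `z ↦ w * chordSlope * (1 + (1 + z) ^ γ)`
at most `1 / 2` in size and `1 / 2`-Lipschitz on `z ≥ -1 / 2`. -/
lemma eventually_isNarrow (γ K : ℝ) : ∀ᶠ w in 𝓝[>] (0 : ℝ), IsNarrow γ K w := by
  have h : ∀ (F : ℝ → ℝ) (b : ℝ), Continuous F → F 0 = 0 → 0 < b →
      ∀ᶠ w in 𝓝[>] (0 : ℝ), F w ≤ b := by
    intro F b hF h0 hb
    have : Tendsto F (𝓝[>] (0 : ℝ)) (𝓝 0) := by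
      have := (hF.tendsto 0).mono_left (nhdsWithin_le_nhds (s := Set.Ioi 0))
      rwa [h0] at this
    exact (this.eventually (gt_mem_nhds hb)).mono fun w hw => le_of_lt hw
  filter_upwards [self_mem_nhdsWithin,
    h (fun w => |γ| * w) 1 (by fun_prop) (by simp) (by norm_num),
    h (fun w => |γ| * w * K) (1 / 2) (by fun_prop) (by simp) (by norm_num),
    h (fun w => w * (2 * (K + 1)) * (1 + 2 ^ (-γ))) (1 / 2) (by fun_prop) (by simp) (by norm_num),
    h (fun w => w * (2 * (K + 1)) * (|γ| * 2 ^ (1 - γ))) (1 / 2) (by fun_prop) (by simp)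
      (by norm_num)] with w h1 h2 h3 h4 h5
  exact ⟨h1, h2, h3, h4, h5⟩

lemma one_sub_slope_mul_ge {γ K w T : ℝ} (h : IsNarrow γ K w) (hT : |T| ≤ K) :
    1 / 2 ≤ 1 - γ * w * T := by
  have h1 : |γ * w * T| ≤ |γ| * w * K := by
    rw [abs_mul, abs_mul, abs_of_pos h.pos]
    exact mul_le_mul_of_nonneg_left hT (mul_nonneg (abs_nonneg _) h.pos.le)
  have := (abs_le.1 (h1.trans h.slope_mul_le)).2
  linarith

lemma abs_chordSlope_le {γ K w T : ℝ} (h : IsNarrow γ K w) (hT : |T| ≤ K) :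
    |chordSlope γ w T| ≤ 2 * (K + 1) := by
  have h1 := one_sub_slope_mul_ge h hT
  have h2 : |T + γ * w| ≤ K + 1 := by
    refine (abs_add_le _ _).trans (add_le_add hT ?_)
    rw [abs_mul, abs_of_pos h.pos]
    exact h.slope_le
  rw [chordSlope, abs_div, abs_of_pos (by linarith : 0 < 1 - γ * w * T),
    div_le_iff₀ (by linarith)]
  have : 0 ≤ K + 1 := by linarith [abs_nonneg T]
  nlinarith

lemma one_add_rpow_le {γ z : ℝ} (hγ : γ < 0) (hz : -(1 / 2) ≤ z) :
    (1 + z) ^ γ ≤ 2 ^ (-γ) := by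
  have : (1 / 2 : ℝ) ^ γ = 2 ^ (-γ) := by
    rw [one_div, Real.inv_rpow (by norm_num), Real.rpow_neg (by norm_num)]
  rw [← this]
  exact Real.rpow_le_rpow_of_nonpos (by norm_num) (by linarith) hγ.le

lemma abs_one_add_rpow_sub_le {γ y z : ℝ} (hγ : γ < 0) (hy : -(1 / 2) ≤ y) (hz : -(1 / 2) ≤ z) :
    |(1 + z) ^ γ - (1 + y) ^ γ| ≤ |γ| * 2 ^ (1 - γ) * |z - y| := by
  have := Convex.norm_image_sub_le_of_norm_hasDerivWithin_le (𝕜 := ℝ) (s := Set.Ici (-(1 / 2) : ℝ))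
    (f := fun t : ℝ => (1 + t) ^ γ) (f' := fun t : ℝ => γ * (1 + t) ^ (γ - 1))
    (C := |γ| * 2 ^ (1 - γ)) (x := y) (y := z) ?_ ?_ (convex_Ici _) hy hz
  · simpa [Real.norm_eq_abs] using this
  · intro t ht
    have ht' : (1 + t : ℝ) ≠ 0 := by have : -(1 / 2 : ℝ) ≤ t := ht; linarith
    have := ((hasDerivAt_id t).const_add 1).rpow_const (p := γ) (Or.inl ht')
    simpa using this.hasDerivWithinAt
  · intro t ht
    rw [Real.norm_eq_abs, abs_mul]
    have ht' : -(1 / 2 : ℝ) ≤ t := ht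
    have h1 := one_add_rpow_le (γ := γ - 1) (by linarith) ht'
    rw [abs_of_nonneg (Real.rpow_nonneg (by linarith) _)]
    rw [show -(γ - 1) = 1 - γ by ring] at h1
    exact mul_le_mul_of_nonneg_left h1 (abs_nonneg _)

/-- The identity minus a `1 / 2`-Lipschitz map increases at rate at least `1 / 2`. Hence the sign of
the defect at a point tells on which side of it the root lies. -/
lemma hitDefect_sub_ge {γ K w T y z : ℝ} (hγ : γ < 0) (h : IsNarrow γ K w) (hT : |T| ≤ K)
    (hy : -(1 / 2) ≤ y) (hyz : y ≤ z) :
    (z - y) / 2 ≤ hitDefect γ w T z - hitDefect γ w T y := by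
  have h1 : |w * chordSlope γ w T * ((1 + z) ^ γ - (1 + y) ^ γ)| ≤ 1 / 2 * (z - y) := by
    rw [abs_mul, abs_mul, abs_of_pos h.pos]
    have h2 := abs_one_add_rpow_sub_le hγ hy (hy.trans hyz)
    rw [abs_of_nonneg (sub_nonneg.2 hyz)] at h2
    have h3 : w * |chordSlope γ w T| ≤ w * (2 * (K + 1)) :=
      mul_le_mul_of_nonneg_left (abs_chordSlope_le h hT) h.pos.le
    calc _ ≤ w * (2 * (K + 1)) * (|γ| * 2 ^ (1 - γ) * (z - y)) :=
          mul_le_mul h3 h2 (abs_nonneg _) ((mul_nonneg h.pos.le (abs_nonneg _)).trans h3)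
      _ = w * (2 * (K + 1)) * (|γ| * 2 ^ (1 - γ)) * (z - y) := by ring
      _ ≤ _ := mul_le_mul_of_nonneg_right h.lip_le (sub_nonneg.2 hyz)
  have := (abs_le.1 h1).2
  unfold hitDefect
  linarith

lemma abs_mul_chordSlope_le {γ K w T z : ℝ} (hγ : γ < 0) (h : IsNarrow γ K w) (hT : |T| ≤ K)
    (hz : -(1 / 2) ≤ z) :
    |w * chordSlope γ w T * (1 + (1 + z) ^ γ)| ≤ w * (2 * (K + 1)) * (1 + 2 ^ (-γ)) := by
  have h0 : (0 : ℝ) ≤ (1 + z) ^ γ := Real.rpow_nonneg (by linarith) _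
  rw [abs_mul, abs_mul, abs_of_pos h.pos, abs_of_nonneg (by linarith : 0 ≤ 1 + (1 + z) ^ γ)]
  have h3 : w * |chordSlope γ w T| ≤ w * (2 * (K + 1)) :=
    mul_le_mul_of_nonneg_left (abs_chordSlope_le h hT) h.pos.le
  exact mul_le_mul h3 (by linarith [one_add_rpow_le hγ hz]) (by linarith)
    ((mul_nonneg h.pos.le (abs_nonneg _)).trans h3)

lemma exists_hitDefect_eq_zero {γ K w T : ℝ} (hγ : γ < 0) (h : IsNarrow γ K w) (hT : |T| ≤ K) :
    ∃ z ∈ Set.Icc (-(1 / 2) : ℝ) (1 / 2), hitDefect γ w T z = 0 := by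
  have hc : ContinuousOn (hitDefect γ w T) (Set.Icc (-(1 / 2) : ℝ) (1 / 2)) := by
    unfold hitDefect
    refine continuousOn_id.sub (continuousOn_const.mul (continuousOn_const.add ?_))
    refine ContinuousOn.rpow_const (by fun_prop) fun z hz => Or.inl ?_
    have := hz.1
    linarith
  have := intermediate_value_Icc (by norm_num : (-(1 / 2) : ℝ) ≤ 1 / 2) hc
  refine this ⟨?_, ?_⟩
  · have := (abs_le.1 (abs_mul_chordSlope_le hγ h hT le_rfl)).1
    unfold hitDefect
    linarith [h.disp_le]
  · have := (abs_le.1 (abs_mul_chordSlope_le hγ h hT (by norm_num : (-(1 / 2) : ℝ) ≤ 1 / 2))).2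
    unfold hitDefect
    linarith [h.disp_le]

open Classical in
/-- The relative displacement as a function of the scaled width and the tangent of the angle. -/
def relDisp (γ K : ℝ) (q : ℝ × ℝ) : ℝ :=
  if h : γ < 0 ∧ IsNarrow γ K q.1 ∧ |q.2| ≤ K then
    (exists_hitDefect_eq_zero h.1 h.2.1 h.2.2).choose
  else 0

lemma relDisp_spec {γ K w T : ℝ} (hγ : γ < 0) (h : IsNarrow γ K w) (hT : |T| ≤ K) :
    relDisp γ K (w, T) ∈ Set.Icc (-(1 / 2) : ℝ) (1 / 2) ∧
      hitDefect γ w T (relDisp γ K (w, T)) = 0 := by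
  have h' : γ < 0 ∧ IsNarrow γ K (w, T).1 ∧ |(w, T).2| ≤ K := ⟨hγ, h, hT⟩
  rw [relDisp, dif_pos h']
  exact (exists_hitDefect_eq_zero h'.1 h'.2.1 h'.2.2).choose_spec

/-- The default value `0` lies in the same interval, so free steps at worst halve or double the
abscissa without any narrowness assumption. -/
lemma relDisp_mem (γ K : ℝ) (q : ℝ × ℝ) :
    relDisp γ K q ∈ Set.Icc (-(1 / 2) : ℝ) (1 / 2) := by
  by_cases h : γ < 0 ∧ IsNarrow γ K q.1 ∧ |q.2| ≤ K
  · exact (relDisp_spec h.1 h.2.1 h.2.2).1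
  · rw [relDisp, dif_neg h]
    norm_num

lemma measurableSet_isNarrow (γ K : ℝ) : MeasurableSet {w | IsNarrow γ K w} := by
  have : {w | IsNarrow γ K w} = {w | 0 < w} ∩ ({w | |γ| * w ≤ 1} ∩ ({w | |γ| * w * K ≤ 1 / 2} ∩
      ({w | w * (2 * (K + 1)) * (1 + 2 ^ (-γ)) ≤ 1 / 2} ∩
        {w | w * (2 * (K + 1)) * (|γ| * 2 ^ (1 - γ)) ≤ 1 / 2}))) := by
    ext w
    exact ⟨fun h => ⟨h.1, h.2, h.3, h.4, h.5⟩, fun h => ⟨h.1, h.2.1, h.2.2.1, h.2.2.2.1, h.2.2.2.2⟩⟩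
  rw [this]
  refine (measurableSet_lt ?_ ?_).inter ((measurableSet_le ?_ ?_).inter ((measurableSet_le ?_ ?_).inter
    ((measurableSet_le ?_ ?_).inter (measurableSet_le ?_ ?_)))) <;> fun_prop

lemma measurable_relDisp {γ : ℝ} (hγ : γ < 0) (K : ℝ) : Measurable (relDisp γ K) := by
  refine measurable_of_Ioi fun c => ?_
  have hD : MeasurableSet {q : ℝ × ℝ | IsNarrow γ K q.1 ∧ |q.2| ≤ K} := by
    exact (measurable_fst (measurableSet_isNarrow γ K)).inter
      (measurableSet_le (continuous_abs.measurable.comp measurable_snd) measurable_const)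
  have hS : Measurable fun q : ℝ × ℝ => hitDefect γ q.1 q.2 c := by
    unfold hitDefect chordSlope
    fun_prop
  -- The root is defined by choice, but by strict monotonicity it exceeds `c` in `[-1 / 2, 1 / 2)`
  -- exactly when the defect at `c` is negative, which is a measurable condition.
  have hN : relDisp γ K ⁻¹' Set.Ioi c =
      ({q : ℝ × ℝ | IsNarrow γ K q.1 ∧ |q.2| ≤ K} ∩
        {q | c < -(1 / 2) ∨ (c < 1 / 2 ∧ hitDefect γ q.1 q.2 c < 0)}) ∪
      ({q : ℝ × ℝ | IsNarrow γ K q.1 ∧ |q.2| ≤ K}ᶜ ∩ {_q | c < 0}) := by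
    ext ⟨w, T⟩
    by_cases hq : IsNarrow γ K w ∧ |T| ≤ K
    · obtain ⟨⟨h1, h2⟩, h3⟩ := relDisp_spec hγ hq.1 hq.2
      simp only [Set.mem_preimage, Set.mem_Ioi, Set.mem_union, Set.mem_inter_iff, Set.mem_ofPred_eq,
        hq, Set.mem_compl_iff, not_true_eq_false, false_and, or_false, true_and, and_self]
      constructor
      · intro hc
        by_cases hc2 : c < -(1 / 2)
        · exact Or.inl hc2
        · refine Or.inr ⟨by linarith, ?_⟩
          have := hitDefect_sub_ge hγ hq.1 hq.2 (not_lt.1 hc2) hc.le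
          linarith
      · rintro (hc | ⟨hc, hd⟩)
        · linarith
        · by_contra hcon
          have := hitDefect_sub_ge hγ hq.1 hq.2 h1 (not_lt.1 hcon)
          linarith [not_lt.1 hcon]
    · have h0 : relDisp γ K (w, T) = 0 := dif_neg fun h => hq h.2
      simp [h0, hq]
  rw [hN]
  refine (hD.inter ?_).union (hD.compl.inter (MeasurableSet.const _))
  exact (MeasurableSet.const _).union ((MeasurableSet.const _).inter
    (measurableSet_lt hS measurable_const))

/-- The abscissa at which the ray from abscissa `x` at angle `a` meets the opposite curve. -/
def freeStep (γ K x a : ℝ) : ℝ := x * (1 + relDisp γ K (x ^ (γ - 1), Real.tan a))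

/-- The horizontal coordinate of the next collision. -/
def nextAbscissa (γ K A x a : ℝ) : ℝ := if A < freeStep γ K x a then freeStep γ K x a else 2 * A

lemma measurable_real_tan : Measurable Real.tan := by
  have : Real.tan = fun x => Real.sin x / Real.cos x := funext Real.tan_eq_sin_div_cos
  rw [this]
  fun_prop

lemma measurable_freeStep {γ : ℝ} (hγ : γ < 0) (K : ℝ) :
    Measurable fun q : ℝ × ℝ => freeStep γ K q.1 q.2 := by
  unfold freeStep
  refine measurable_fst.mul (measurable_const.add ((measurable_relDisp hγ K).comp ?_))
  exact (measurable_fst.pow_const _).prodMk (measurable_real_tan.comp measurable_snd)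

lemma measurable_nextAbscissa {γ : ℝ} (hγ : γ < 0) (K A : ℝ) :
    Measurable fun q : ℝ × ℝ => nextAbscissa γ K A q.1 q.2 := by
  unfold nextAbscissa
  exact Measurable.ite (measurableSet_lt measurable_const (measurable_freeStep hγ K))
    (measurable_freeStep hγ K) measurable_const

lemma freeStep_ge {γ K x : ℝ} (hx : 0 ≤ x) (a : ℝ) : x / 2 ≤ freeStep γ K x a := by
  have := (relDisp_mem γ K (x ^ (γ - 1), Real.tan a)).1
  unfold freeStep
  nlinarith

lemma freeStep_le {γ K x : ℝ} (hx : 0 ≤ x) (a : ℝ) : freeStep γ K x a ≤ 2 * x := by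
  have := (relDisp_mem γ K (x ^ (γ - 1), Real.tan a)).2
  unfold freeStep
  nlinarith

lemma lt_nextAbscissa {γ K A x a : ℝ} (hA : 0 < A) : A < nextAbscissa γ K A x a := by
  unfold nextAbscissa
  split_ifs with h
  · exact h
  · linarith

lemma nextAbscissa_le {γ K A x a : ℝ} (hA : 0 < A) (hx : A ≤ x) :
    nextAbscissa γ K A x a ≤ 2 * x := by
  unfold nextAbscissa
  split_ifs with h
  · exact freeStep_le (by linarith) a
  · linarith

/-! ### The boundary of the tube and the first hit -/

/-- Truncation at `A` avoids a possible singularity of the power at `0` and changes nothing where `x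
≥ A`. -/
lemma continuous_max_rpow {A : ℝ} (hA : 0 < A) (γ : ℝ) :
    Continuous fun x : ℝ => max x A ^ γ :=
  (continuous_id.max continuous_const).rpow_const fun x =>
    Or.inl (lt_of_lt_of_le hA (le_max_right x A)).ne'

lemma isOpen_tube {γ A : ℝ} (hA : 0 < A) : IsOpen (tube (fun x => x ^ γ) A) := by
  have : tube (fun x => x ^ γ) A = {p | A < p.1} ∩ {p | |p.2| < max p.1 A ^ γ} := by
    ext p
    refine and_congr_right fun h => ?_
    rw [Set.mem_ofPred_eq, max_eq_left h.le]
  rw [this]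
  exact (isOpen_lt continuous_const continuous_fst).inter
    (isOpen_lt continuous_snd.abs ((continuous_max_rpow hA γ).comp continuous_fst))

lemma closure_tube {γ A : ℝ} (hA : 0 < A) :
    closure (tube (fun x => x ^ γ) A) = {p | A ≤ p.1 ∧ |p.2| ≤ p.1 ^ γ} := by
  apply Set.Subset.antisymm
  · have h1 : {p : ℝ × ℝ | A ≤ p.1 ∧ |p.2| ≤ p.1 ^ γ} =
        {p | A ≤ p.1} ∩ {p | |p.2| ≤ max p.1 A ^ γ} := by
      ext p
      refine and_congr_right fun h => ?_
      rw [Set.mem_ofPred_eq, max_eq_left h]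
    have h2 : IsClosed {p : ℝ × ℝ | A ≤ p.1 ∧ |p.2| ≤ p.1 ^ γ} := by
      rw [h1]
      exact (isClosed_le continuous_const continuous_fst).inter
        (isClosed_le continuous_snd.abs ((continuous_max_rpow hA γ).comp continuous_fst))
    exact closure_minimal (fun p hp => ⟨hp.1.le, hp.2.le⟩) h2
  · rintro ⟨u, y⟩ ⟨hu, hy⟩
    simp only at hu hy
    have hu0 : 0 < u := hA.trans_le hu
    have hgu : 0 < u ^ γ := Real.rpow_pos_of_pos hu0 γ
    -- Move right by `s` and shrink the height relative to the half-width by `1 - s`: this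
    -- approaches every boundary point, corners included, from inside.
    have ht : Tendsto (fun s : ℝ => (u + s, (1 - s) * y * (u + s) ^ γ / u ^ γ)) (𝓝[>] 0)
        (𝓝 (u, y)) := by
      have hc : ContinuousAt (fun s : ℝ => (u + s, (1 - s) * y * (u + s) ^ γ / u ^ γ)) 0 := by
        refine ContinuousAt.prodMk (by fun_prop) ?_
        refine ContinuousAt.div_const (ContinuousAt.mul (by fun_prop) ?_) _
        exact ContinuousAt.rpow_const (by fun_prop) (Or.inl (by simpa using hu0.ne'))
      have := hc.tendsto
      simp only [add_zero, sub_zero, one_mul, mul_div_assoc, div_self hgu.ne', mul_one] at this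
      simpa only [mul_div_assoc] using this.mono_left nhdsWithin_le_nhds
    refine mem_closure_of_tendsto ht ?_
    filter_upwards [Ioo_mem_nhdsGT (zero_lt_one' ℝ)] with s hs
    have hs0 : 0 < u + s := by linarith [hs.1]
    have hgs : 0 < (u + s) ^ γ := Real.rpow_pos_of_pos hs0 γ
    refine ⟨by change A < u + s; linarith [hs.1], ?_⟩
    change |(1 - s) * y * (u + s) ^ γ / u ^ γ| < (u + s) ^ γ
    rw [abs_div, abs_mul, abs_mul, abs_of_pos hgs, abs_of_pos hgu,
      abs_of_pos (by linarith [hs.2] : 0 < 1 - s), div_lt_iff₀ hgu, mul_comm ((u + s) ^ γ)]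
    refine mul_lt_mul_of_pos_right ?_ hgs
    have := hs.1
    have := hs.2
    nlinarith

lemma mem_frontier_tube {γ A : ℝ} (hA : 0 < A) (p : ℝ × ℝ) :
    p ∈ frontier (tube (fun x => x ^ γ) A) ↔
      (A ≤ p.1 ∧ |p.2| ≤ p.1 ^ γ) ∧ ¬ (A < p.1 ∧ |p.2| < p.1 ^ γ) := by
  rw [(isOpen_tube hA).frontier_eq, closure_tube hA]
  rfl

/-- Along a chord parametrised by vertical distance, the half-width changes at rate at most `1 / 2`
while the height changes at rate `1`. So the chord leaves its starting curve at once and cannot meet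
the opposite one early. -/
lemma abs_rpow_sub_rpow_le {γ K x T s t : ℝ} (hγ : γ < 0) (hx : 0 < x)
    (h : IsNarrow γ K (x ^ (γ - 1))) (hT : |T| ≤ K)
    (hs : x / 2 ≤ x + s * chordSlope γ (x ^ (γ - 1)) T)
    (ht : x / 2 ≤ x + t * chordSlope γ (x ^ (γ - 1)) T) :
    |(x + s * chordSlope γ (x ^ (γ - 1)) T) ^ γ - (x + t * chordSlope γ (x ^ (γ - 1)) T) ^ γ| ≤
      |s - t| / 2 := by
  have hS := abs_chordSlope_le h hT
  set w := x ^ (γ - 1) with hw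
  set S := chordSlope γ w T
  have key : ∀ r : ℝ, x / 2 ≤ x + r * S →
      -(1 / 2) ≤ r * S / x ∧ (x + r * S) ^ γ = x ^ γ * (1 + r * S / x) ^ γ := by
    intro r hr
    have h1 : -(1 / 2) ≤ r * S / x := by
      rw [le_div_iff₀ hx]
      linarith
    refine ⟨h1, ?_⟩
    rw [← Real.mul_rpow hx.le (by linarith)]
    congr 1
    field_simp
  obtain ⟨h1, h2⟩ := key s hs
  obtain ⟨h3, h4⟩ := key t ht
  have hxg : x ^ γ = w * x := by
    rw [hw, ← Real.rpow_add_one hx.ne']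
    congr 1
    ring
  rw [h2, h4, ← mul_sub, abs_mul, abs_of_pos (Real.rpow_pos_of_pos hx γ), hxg]
  have h5 := abs_one_add_rpow_sub_le hγ h3 h1
  have h6 : s * S / x - t * S / x = (s - t) * S / x := by ring
  rw [h6, abs_div, abs_mul, abs_of_pos hx] at h5
  calc _ ≤ w * x * (|γ| * 2 ^ (1 - γ) * (|s - t| * |S| / x)) :=
        mul_le_mul_of_nonneg_left h5 (mul_pos h.pos hx).le
    _ = w * |S| * (|γ| * 2 ^ (1 - γ)) * |s - t| := by field_simp
    _ ≤ w * (2 * (K + 1)) * (|γ| * 2 ^ (1 - γ)) * |s - t| := by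
        have := h.pos
        gcongr
    _ ≤ 1 / 2 * |s - t| := mul_le_mul_of_nonneg_right h.lip_le (abs_nonneg _)
    _ = _ := by ring

lemma freeStep_eq {γ K x a : ℝ} (hγ : γ < 0) (hx : 0 < x) (h : IsNarrow γ K (x ^ (γ - 1)))
    (hT : |Real.tan a| ≤ K) :
    freeStep γ K x a = x + (x ^ γ + freeStep γ K x a ^ γ) *
      chordSlope γ (x ^ (γ - 1)) (Real.tan a) := by
  obtain ⟨⟨h1, h2⟩, h3⟩ := relDisp_spec hγ h hT
  have h4 : freeStep γ K x a ^ γ =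
      x ^ γ * (1 + relDisp γ K (x ^ (γ - 1), Real.tan a)) ^ γ := by
    rw [freeStep, Real.mul_rpow hx.le (by linarith)]
  have hxg : x ^ γ = x ^ (γ - 1) * x := by
    rw [← Real.rpow_add_one hx.ne']
    congr 1
    ring
  rw [h4, hxg]
  unfold hitDefect at h3
  unfold freeStep
  linear_combination x * h3

/-- The open chord between two consecutive collisions lies between the two curves. -/
lemma chord_bounds {γ K x a s : ℝ} (hγ : γ < 0) (hx : 0 < x) (h : IsNarrow γ K (x ^ (γ - 1)))
    (hT : |Real.tan a| ≤ K) (hs0 : 0 ≤ s) (hs1 : s ≤ x ^ γ + freeStep γ K x a ^ γ) :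
    x ^ γ - s + s / 2 ≤ (x + s * chordSlope γ (x ^ (γ - 1)) (Real.tan a)) ^ γ ∧
    s - x ^ γ + (x ^ γ + freeStep γ K x a ^ γ - s) / 2 ≤
      (x + s * chordSlope γ (x ^ (γ - 1)) (Real.tan a)) ^ γ := by
  have hu := freeStep_eq hγ hx h hT
  have hge := freeStep_ge (γ := γ) (K := K) hx.le a
  set u := freeStep γ K x a
  set S := chordSlope γ (x ^ (γ - 1)) (Real.tan a) with hS
  -- The abscissa is affine in `s` and is at least `x / 2` at both ends of the chord.
  have hv : x / 2 ≤ x + s * S := by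
    rcases le_total 0 S with hS0 | hS0
    · nlinarith
    · nlinarith [mul_le_mul_of_nonpos_right hs1 hS0]
  constructor
  · have := abs_rpow_sub_rpow_le (s := s) (t := 0) hγ hx h hT hv (by linarith)
    rw [zero_mul, add_zero, sub_zero, abs_of_nonneg hs0] at this
    have := (abs_le.1 this).1
    linarith
  · have := abs_rpow_sub_rpow_le (s := s) (t := x ^ γ + u ^ γ) hγ hx h hT hv
      (by rw [← hS, ← hu]; exact hge)
    rw [← hS, ← hu, abs_of_nonpos (sub_nonpos.2 hs1)] at this
    have := (abs_le.1 this).1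
    linarith

/-- Normalises the ray to unit vertical speed; the sign `σ` then drops out of the horizontal motion.
-/
lemma rayDirection_eq {γ K x a σ : ℝ} (hx : 0 < x) (h : IsNarrow γ K (x ^ (γ - 1)))
    (ha : 0 < Real.cos a) (hT : |Real.tan a| ≤ K) (hσ : σ = 1 ∨ σ = -1) :
    rayDirection (fun x => x ^ γ) (x, σ * x ^ γ) a =
      (Real.cos a * (1 - γ * x ^ (γ - 1) * Real.tan a)) •
        (chordSlope γ (x ^ (γ - 1)) (Real.tan a), -σ) := by
  have hd : deriv (fun x : ℝ => x ^ γ) x = γ * x ^ (γ - 1) :=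
    (Real.hasDerivAt_rpow_const (Or.inl hx.ne')).deriv
  have h1 := one_sub_slope_mul_ge h hT
  have hg := Real.rpow_pos_of_pos hx γ
  have hsin : Real.sin a = Real.cos a * Real.tan a := by
    rw [Real.tan_eq_sin_div_cos]
    field_simp
  have hfst : (Real.cos a * (1 - γ * x ^ (γ - 1) * Real.tan a)) *
      chordSlope γ (x ^ (γ - 1)) (Real.tan a) =
      Real.cos a * (Real.tan a + γ * x ^ (γ - 1)) := by
    rw [chordSlope, mul_assoc, mul_div_cancel₀ _ (by linarith)]
  have hneg : ¬ x ^ γ < 0 := by linarith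
  unfold rayDirection inwardNormal rightTangent
  rcases hσ with rfl | rfl
  · ext
    · simp only [hd, one_mul, hg, if_true, Prod.fst_add, Prod.smul_fst, smul_eq_mul, hfst, hsin]
      ring
    · simp only [hd, one_mul, hg, if_true, Prod.snd_add, Prod.smul_snd, smul_eq_mul, hsin]
      ring
  · ext
    · simp only [hd, Prod.fst_add, Prod.smul_fst, smul_eq_mul, hfst, hsin]
      ring
    · simp only [hd, neg_mul, one_mul, Left.neg_pos_iff, hneg, if_false, Prod.snd_add,
        Prod.smul_snd, smul_eq_mul, hsin]
      ring

lemma firstHit_eq {γ A x σ l S s : ℝ} {a : ℝ} (hA : 0 < A) (hσ : σ = 1 ∨ σ = -1) (hl : 0 < l)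
    (hray : rayDirection (fun x => x ^ γ) (x, σ * x ^ γ) a = l • (S, -σ)) (hs : 0 < s)
    (hin : ∀ r, 0 < r → r < s → A < x + r * S ∧ |x ^ γ - r| < (x + r * S) ^ γ)
    (hfr : (A ≤ x + s * S ∧ |x ^ γ - s| ≤ (x + s * S) ^ γ) ∧
      ¬ (A < x + s * S ∧ |x ^ γ - s| < (x + s * S) ^ γ)) :
    (hitTimes (fun x => x ^ γ) A (x, σ * x ^ γ) a).Nonempty ∧
      firstHit (fun x => x ^ γ) A (x, σ * x ^ γ) a = (x + s * S, σ * (x ^ γ - s)) := by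
  have hpt : ∀ t : ℝ, (x, σ * x ^ γ) + t • rayDirection (fun x => x ^ γ) (x, σ * x ^ γ) a =
      (x + t * l * S, σ * (x ^ γ - t * l)) := by
    intro t
    rw [hray]
    ext
    · simp [mul_assoc]
    · simp only [Prod.snd_add, Prod.smul_snd, smul_eq_mul]
      ring
  have habs : ∀ y : ℝ, |σ * y| = |y| := by
    intro y
    rcases hσ with rfl | rfl <;> simp
  have hleast : IsLeast (hitTimes (fun x => x ^ γ) A (x, σ * x ^ γ) a) (s / l) := by
    constructor
    · refine ⟨div_pos hs hl, ?_⟩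
      rw [hpt, mem_frontier_tube hA, div_mul_cancel₀ _ hl.ne', habs]
      exact hfr
    · rintro t ⟨ht0, ht⟩
      rw [hpt, mem_frontier_tube hA, habs] at ht
      by_contra hlt
      rw [not_le, lt_div_iff₀ hl] at hlt
      exact ht.2 (hin _ (mul_pos ht0 hl) hlt)
  refine ⟨⟨_, hleast.1⟩, ?_⟩
  rw [firstHit, hleast.csInf_eq, hpt, div_mul_cancel₀ _ hl.ne']

lemma nextCollision_eq {γ K A x a σ : ℝ} (hγ : γ < 0) (hA : 0 < A) (hx : A < x)
    (h : IsNarrow γ K (x ^ (γ - 1))) (ha : 0 < Real.cos a) (hT : |Real.tan a| ≤ K)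
    (hσ : σ = 1 ∨ σ = -1) :
    ∃ σ' : ℝ, (σ' = 1 ∨ σ' = -1) ∧
      nextCollision (fun x => x ^ γ) A (x, σ * x ^ γ) a =
        some (nextAbscissa γ K A x a, σ' * nextAbscissa γ K A x a ^ γ) := by
  have hx0 : 0 < x := hA.trans hx
  have hray := rayDirection_eq hx0 h ha hT hσ
  have hl : 0 < Real.cos a * (1 - γ * x ^ (γ - 1) * Real.tan a) :=
    mul_pos ha (by linarith [one_sub_slope_mul_ge h hT])
  have hu := freeStep_eq hγ hx0 h hT
  have hu0 : 0 < freeStep γ K x a := by linarith [freeStep_ge (γ := γ) (K := K) hx0.le a]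
  have hb := fun s => chord_bounds (s := s) hγ hx0 h hT
  have hgx := Real.rpow_pos_of_pos hx0 γ
  have hgu := Real.rpow_pos_of_pos hu0 γ
  unfold nextAbscissa
  generalize freeStep γ K x a = u at *
  generalize chordSlope γ (x ^ (γ - 1)) (Real.tan a) = S at *
  have hstrict : ∀ r, 0 < r → r < x ^ γ + u ^ γ → |x ^ γ - r| < (x + r * S) ^ γ := by
    intro r hr0 hr1
    obtain ⟨h1, h2⟩ := hb r hr0.le hr1.le
    rw [abs_lt]
    constructor <;> linarith
  by_cases hAu : A < u
  · rw [if_pos hAu]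
    have hin : ∀ r, 0 < r → r < x ^ γ + u ^ γ →
        A < x + r * S ∧ |x ^ γ - r| < (x + r * S) ^ γ := by
      refine fun r hr0 hr1 => ⟨?_, hstrict r hr0 hr1⟩
      rcases le_total 0 S with hS | hS
      · nlinarith
      · nlinarith [mul_le_mul_of_nonpos_right hr1.le hS]
    obtain ⟨hne, hfirst⟩ := firstHit_eq hA hσ hl hray (by linarith) hin (by
      rw [← hu, show x ^ γ - (x ^ γ + u ^ γ) = -u ^ γ by ring, abs_neg, abs_of_pos hgu]
      exact ⟨⟨hAu.le, le_rfl⟩, fun hh => lt_irrefl _ hh.2⟩)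
    rw [← hu] at hfirst
    refine ⟨-σ, by rcases hσ with rfl | rfl <;> simp, ?_⟩
    rw [nextCollision, if_pos hne, hfirst, if_neg hAu.ne']
    congr 2
    ring
  · rw [if_neg hAu]
    rw [not_lt] at hAu
    -- The opposite curve would be met at or to the left of `A`, so the chord goes left and crosses
    -- `x = A` after vertical distance `(x - A) / (-S)`, at the latest at its end. A hit exactly in
    -- the corner belongs to this case.
    have hS : S < 0 := by
      by_contra hS
      have := mul_nonneg (by linarith : 0 ≤ x ^ γ + u ^ γ) (not_lt.1 hS)
      linarith
    have hsS : (x - A) / (-S) * S = A - x := by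
      rw [div_neg, neg_mul, div_mul_cancel₀ _ hS.ne, neg_sub]
    have hs0 : 0 < (x - A) / (-S) := div_pos (by linarith) (by linarith)
    generalize (x - A) / (-S) = s at *
    have hs1 : s ≤ x ^ γ + u ^ γ := by
      by_contra hcon
      have := mul_lt_mul_of_neg_right (not_le.1 hcon) hS
      linarith
    have hAs : x + s * S = A := by linarith
    have hin : ∀ r, 0 < r → r < s → A < x + r * S ∧ |x ^ γ - r| < (x + r * S) ^ γ :=
      fun r hr0 hr1 => ⟨by nlinarith [mul_lt_mul_of_neg_right hr1 hS],
        hstrict r hr0 (hr1.trans_le hs1)⟩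
    obtain ⟨hne, hfirst⟩ := firstHit_eq hA hσ hl hray hs0 hin (by
      obtain ⟨h1, h2⟩ := hb s hs0.le hs1
      refine ⟨⟨hAs.ge, ?_⟩, fun hh => by linarith [hh.1]⟩
      rw [abs_le]
      constructor <;> linarith)
    rw [hAs] at hfirst
    refine ⟨1, Or.inl rfl, ?_⟩
    rw [nextCollision, if_pos hne, hfirst, if_pos rfl, one_mul]

/-! ### The horizontal coordinates as an autonomous recursion -/

/-- The recursion driven by `a`, with update `H (state, input)`. -/
def chain (H : ℝ × ℝ → ℝ) (x : ℝ) (a : ℕ → ℝ) : ℕ → ℝ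
  | 0 => x
  | k + 1 => H (chain H x a k, a k)

lemma chain_mem {H : ℝ × ℝ → ℝ} {S : Set ℝ} {x : ℝ} (hx : x ∈ S)
    (hS : ∀ y ∈ S, ∀ b, H (y, b) ∈ S) (a : ℕ → ℝ) (k : ℕ) : chain H x a k ∈ S := by
  induction k with
  | zero => exact hx
  | succ k ih => exact hS _ ih _

/-- The horizontal coordinates of the collisions as an autonomous recursion. -/
def abscissa (γ K A x : ℝ) (a : ℕ → ℝ) : ℕ → ℝ :=
  chain (fun q => nextAbscissa γ K A q.1 q.2) x a

lemma lt_abscissa {γ K A x : ℝ} (hA : 0 < A) (hx : A < x) (a : ℕ → ℝ) (k : ℕ) :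
    A < abscissa γ K A x a k :=
  chain_mem (S := Set.Ioi A) hx (fun _ _ _ => lt_nextAbscissa hA) a k

lemma collisions_eq {γ K A : ℝ} {p : ℝ × ℝ} {a : ℕ → ℝ} (hγ : γ < 0) (hA : 0 < A)
    (hK : ∀ x, A < x → IsNarrow γ K (x ^ (γ - 1)))
    (hp : p ∈ frontier (tube (fun x => x ^ γ) A)) (hpA : A < p.1)
    (ha : ∀ k, 0 < Real.cos (a k) ∧ |Real.tan (a k)| ≤ K) (k : ℕ) :
    ∃ σ : ℝ, (σ = 1 ∨ σ = -1) ∧ collisions (fun x => x ^ γ) A p a k =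
      some (abscissa γ K A p.1 a k, σ * abscissa γ K A p.1 a k ^ γ) := by
  induction k with
  | zero =>
    rw [mem_frontier_tube hA] at hp
    -- A boundary point strictly to the right of `A` lies on one of the two curves.
    have h1 : |p.2| = p.1 ^ γ :=
      le_antisymm hp.1.2 (not_lt.1 fun hlt => hp.2 ⟨hpA, hlt⟩)
    rcases abs_choice p.2 with h2 | h2
    · refine ⟨1, Or.inl rfl, ?_⟩
      change some p = some (p.1, 1 * p.1 ^ γ)
      rw [one_mul, ← h1, h2]
    · refine ⟨-1, Or.inr rfl, ?_⟩
      change some p = some (p.1, -1 * p.1 ^ γ)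
      rw [← h1, h2, neg_mul_neg, one_mul]
  | succ k ih =>
    obtain ⟨σ, hσ, hc⟩ := ih
    have hlt := lt_abscissa (γ := γ) (K := K) hA hpA a k
    obtain ⟨σ', hσ', hn⟩ := nextCollision_eq hγ hA hlt (hK _ hlt) (ha k).1 (ha k).2 hσ
    refine ⟨σ', hσ', ?_⟩
    rw [collisions, hc]
    exact hn

/-! ### Expansion of the displacement, uniform in the angle -/

lemma binomialSeries_coeff_eq (k : ℝ) :
    (binomialSeries ℝ k).coeff 0 = 1 ∧ (binomialSeries ℝ k).coeff 1 = k ∧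
      (binomialSeries ℝ k).coeff 2 = k * (k - 1) / 2 := by
  refine ⟨?_, ?_, ?_⟩
  · simp [binomialSeries, FormalMultilinearSeries.coeff_ofScalars]
  · simp [binomialSeries, FormalMultilinearSeries.coeff_ofScalars]
  · simp [binomialSeries, FormalMultilinearSeries.coeff_ofScalars, Ring.choose_eq_smul,
      descPochhammer_succ_right, Polynomial.smeval_mul, Polynomial.smeval_sub, Polynomial.smeval_X,
      Polynomial.smeval_one]
    ring

lemma one_add_rpow_taylor_one (k : ℝ) :
    (fun z : ℝ => (1 + z) ^ k - 1 - k * z) =O[𝓝 0] fun z => z ^ 2 := by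
  have h := (Real.one_add_rpow_hasFPowerSeriesAt_zero (a := k)).isBigO_sub_partialSum_pow 2
  obtain ⟨h0, h1, h2⟩ := binomialSeries_coeff_eq k
  refine (h.congr_left fun z => ?_).trans (Asymptotics.isBigO_of_le _ fun z => by simp)
  simp [FormalMultilinearSeries.partialSum, Finset.sum_range_succ, h0, h1]
  ring

lemma one_add_rpow_taylor_two (k : ℝ) :
    (fun z : ℝ => (1 + z) ^ k - 1 - k * z - k * (k - 1) / 2 * z ^ 2) =O[𝓝 0] fun z => z ^ 3 := by
  have h := (Real.one_add_rpow_hasFPowerSeriesAt_zero (a := k)).isBigO_sub_partialSum_pow 3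
  obtain ⟨h0, h1, h2⟩ := binomialSeries_coeff_eq k
  refine (h.congr_left fun z => ?_).trans (Asymptotics.isBigO_of_le _ fun z => by simp)
  simp [FormalMultilinearSeries.partialSum, Finset.sum_range_succ, h0, h1, h2]
  ring

/-- The scaled width tends to zero while the tangent stays in `[-K, K]`. -/
def narrowFilter (K : ℝ) : Filter (ℝ × ℝ) := 𝓝[>] (0 : ℝ) ×ˢ 𝓟 {T | |T| ≤ K}

/-- `F` is of order `w ^ n`, uniformly in the tangent. -/
def IsOrder (K : ℝ) (n : ℕ) (F : ℝ × ℝ → ℝ) : Prop := F =O[narrowFilter K] fun q => q.1 ^ n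

namespace IsOrder

variable {K : ℝ} {m n : ℕ} {F G : ℝ × ℝ → ℝ}

lemma mul (hF : IsOrder K m F) (hG : IsOrder K n G) : IsOrder K (m + n) fun q => F q * G q :=
  (Asymptotics.IsBigO.mul hF hG).congr_right fun q => (pow_add q.1 m n).symm

lemma add (hF : IsOrder K n F) (hG : IsOrder K n G) : IsOrder K n fun q => F q + G q :=
  Asymptotics.IsBigO.add hF hG

lemma const_mul (hF : IsOrder K n F) (c : ℝ) : IsOrder K n fun q => c * F q :=
  Asymptotics.IsBigO.const_mul_left hF c

lemma congr (hF : IsOrder K n F) (h : ∀ᶠ q in narrowFilter K, F q = G q) : IsOrder K n G :=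
  Asymptotics.IsBigO.congr' hF h EventuallyEq.rfl

lemma of_bound (C : ℝ) (h : ∀ᶠ q in narrowFilter K, |F q| ≤ C * q.1 ^ n) : IsOrder K n F := by
  refine Asymptotics.IsBigO.of_bound (|C|) (h.mono fun q hq => ?_)
  rw [Real.norm_eq_abs, Real.norm_eq_abs]
  calc _ ≤ C * q.1 ^ n := hq
    _ ≤ |C * q.1 ^ n| := le_abs_self _
    _ = _ := abs_mul _ _

end IsOrder

lemma eventually_narrow (γ K : ℝ) : ∀ᶠ q in narrowFilter K, IsNarrow γ K q.1 ∧ |q.2| ≤ K := by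
  rw [narrowFilter, eventually_prod_principal_iff]
  filter_upwards [eventually_isNarrow γ K] with w hw T hT
  exact ⟨hw, hT⟩

lemma tendsto_fst_narrowFilter (K : ℝ) : Tendsto Prod.fst (narrowFilter K) (𝓝 (0 : ℝ)) :=
  tendsto_fst.mono_right nhdsWithin_le_nhds

lemma isOrder_mono {K : ℝ} {m n : ℕ} {F : ℝ × ℝ → ℝ} (hF : IsOrder K n F) (hmn : m ≤ n) :
    IsOrder K m F := by
  obtain ⟨j, rfl⟩ := Nat.exists_eq_add_of_le hmn
  refine Asymptotics.IsBigO.trans hF ?_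
  have h1 : (fun q : ℝ × ℝ => q.1 ^ j) =O[narrowFilter K] fun _ => (1 : ℝ) :=
    ((tendsto_fst_narrowFilter K).pow j).isBigO_one ℝ
  refine ((Asymptotics.isBigO_refl (fun q : ℝ × ℝ => q.1 ^ m) _).mul h1).congr
    (fun q => (pow_add _ _ _).symm) (fun q => mul_one _)

lemma isOrder_fst (K : ℝ) : IsOrder K 1 fun q => q.1 :=
  (Asymptotics.isBigO_refl _ _).congr_right fun _ => (pow_one _).symm

lemma isOrder_snd (K : ℝ) : IsOrder K 0 fun q => q.2 :=
  IsOrder.of_bound K ((eventually_narrow 0 K).mono fun _ hq => by simpa using hq.2)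

lemma isOrder_const (K c : ℝ) : IsOrder K 0 fun _ => c :=
  IsOrder.of_bound |c| (Eventually.of_forall fun _ => by simp)

/-- The remainder is exactly `γ² w² T (1 + T²) / (1 - γ w T)`, whose denominator is at least `1 /
2`. -/
lemma isOrder_chordSlope_sub (γ K : ℝ) :
    IsOrder K 2 fun q => chordSlope γ q.1 q.2 - q.2 - γ * q.1 * (1 + q.2 ^ 2) := by
  have hd : IsOrder K 0 fun q => (1 - γ * q.1 * q.2)⁻¹ := by
    refine IsOrder.of_bound 2 ((eventually_narrow γ K).mono fun q hq => ?_)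
    have := one_sub_slope_mul_ge hq.1 hq.2
    rw [abs_inv, abs_of_pos (by linarith), pow_zero, mul_one]
    exact (inv_le_comm₀ (by linarith) (by norm_num)).2 (by linarith)
  have hT2 := (isOrder_const K 1).add ((isOrder_snd K).mul (isOrder_snd K))
  have := ((((isOrder_fst K).mul (isOrder_fst K)).mul (isOrder_snd K)).mul hT2).mul hd
  refine (this.const_mul (γ ^ 2)).congr ((eventually_narrow γ K).mono fun q hq => ?_)
  have := one_sub_slope_mul_ge hq.1 hq.2
  have h0 : 1 - γ * q.1 * q.2 ≠ 0 := by linarith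
  unfold chordSlope
  field_simp
  ring

lemma isOrder_relDisp {γ : ℝ} (hγ : γ < 0) (K : ℝ) : IsOrder K 1 (relDisp γ K) := by
  refine IsOrder.of_bound (2 * (K + 1) * (1 + 2 ^ (-γ)))
    ((eventually_narrow γ K).mono fun q hq => ?_)
  obtain ⟨⟨h1, h2⟩, h3⟩ := relDisp_spec hγ hq.1 hq.2
  have h4 := abs_mul_chordSlope_le hγ hq.1 hq.2 h1
  unfold hitDefect at h3
  rw [← sub_eq_zero.1 h3] at h4
  linarith

lemma tendsto_relDisp {γ : ℝ} (hγ : γ < 0) (K : ℝ) :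
    Tendsto (relDisp γ K) (narrowFilter K) (𝓝 0) := by
  refine Asymptotics.IsBigO.trans_tendsto (isOrder_relDisp hγ K) ?_
  simpa using tendsto_fst_narrowFilter K

lemma isOrder_comp_relDisp {γ : ℝ} (hγ : γ < 0) (K : ℝ) {R : ℝ → ℝ} {n : ℕ}
    (hR : R =O[𝓝 0] fun z => z ^ n) : IsOrder K n fun q => R (relDisp γ K q) := by
  refine (hR.comp_tendsto (tendsto_relDisp hγ K)).trans ?_
  exact ((isOrder_relDisp hγ K).pow n).congr_right fun q => by rw [pow_one]

/-- Bootstrap in `z = w S (1 + (1 + z) ^ γ)`: inserting `z = O(w)` gives `z` to first order, and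
inserting that again gives the second-order term. -/
lemma isOrder_relDisp_sub_two {γ : ℝ} (hγ : γ < 0) (K : ℝ) :
    IsOrder K 2 (fun q => relDisp γ K q - 2 * (q.1 * q.2)) ∧
    IsOrder K 3 (fun q => relDisp γ K q - 2 * (q.1 * q.2) -
      2 * γ * q.1 ^ 2 * (1 + 2 * q.2 ^ 2)) := by
  have hw := isOrder_fst K
  have hT := isOrder_snd K
  have hz := isOrder_relDisp hγ K
  have hS2 := isOrder_chordSlope_sub γ K
  have hr := isOrder_comp_relDisp hγ K (one_add_rpow_taylor_one γ)
  have hS1 : IsOrder K 1 fun q => chordSlope γ q.1 q.2 - q.2 := by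
    have := (isOrder_mono hS2 one_le_two).add
      ((hw.mul ((isOrder_const K 1).add (hT.mul hT))).const_mul γ)
    exact this.congr (Eventually.of_forall fun _ => by ring)
  have hS0 : IsOrder K 0 fun q => chordSlope γ q.1 q.2 :=
    ((isOrder_mono hS1 zero_le_one).add hT).congr (Eventually.of_forall fun _ => by ring)
  have heq : ∀ᶠ q in narrowFilter K, relDisp γ K q =
      q.1 * chordSlope γ q.1 q.2 * (1 + (1 + relDisp γ K q) ^ γ) :=
    (eventually_narrow γ K).mono fun q hq => sub_eq_zero.1 (relDisp_spec hγ hq.1 hq.2).2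
  have hz2 : IsOrder K 2 (fun q => relDisp γ K q - 2 * (q.1 * q.2)) := by
    have h1 := (hw.mul hS1).const_mul 2
    have h2 := hw.mul (hS0.mul ((hz.const_mul γ).add (isOrder_mono hr one_le_two)))
    refine (h1.add h2).congr (heq.mono fun q hq => ?_)
    linear_combination -hq
  refine ⟨hz2, ?_⟩
  have h1 := (hw.mul hS2).const_mul 2
  have h2 := ((hw.mul ((hT.mul hz2))).add (hw.mul (hS1.mul hz))).const_mul γ
  have h3 := hw.mul (hS0.mul hr)
  refine (IsOrder.add (IsOrder.add h1 h2) h3).congr (heq.mono fun q hq => ?_)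
  linear_combination -hq

lemma isOrder_one_add_relDisp_rpow {γ : ℝ} (hγ : γ < 0) (K k : ℝ) :
    IsOrder K 3 fun q => (1 + relDisp γ K q) ^ k - 1 - 2 * k * (q.1 * q.2) -
      q.1 ^ 2 * (2 * k * (γ * (1 + 2 * q.2 ^ 2) + (k - 1) * q.2 ^ 2)) := by
  obtain ⟨hz2, hz3⟩ := isOrder_relDisp_sub_two hγ K
  have hz := isOrder_relDisp hγ K
  have hr := isOrder_comp_relDisp hγ K (one_add_rpow_taylor_two k)
  have hwT := ((isOrder_fst K).mul (isOrder_snd K)).const_mul 2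
  have h2 := (hz2.mul (hz.add hwT)).const_mul (k * (k - 1) / 2)
  exact (IsOrder.add (IsOrder.add (hz3.const_mul k) h2) hr).congr
    (Eventually.of_forall fun _ => by ring)

lemma exists_one_add_relDisp_rpow_bound {γ : ℝ} (hγ : γ < 0) (K k : ℝ) :
    ∃ C, 0 < C ∧ ∀ᶠ w in 𝓝[>] (0 : ℝ), ∀ T, |T| ≤ K →
      |(1 + relDisp γ K (w, T)) ^ k - 1 - 2 * k * (w * T) -
        w ^ 2 * (2 * k * (γ * (1 + 2 * T ^ 2) + (k - 1) * T ^ 2))| ≤ C * w ^ 3 := by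
  obtain ⟨C, hC, h⟩ := (isOrder_one_add_relDisp_rpow hγ K k).exists_pos
  have h' := h.bound
  rw [narrowFilter, eventually_prod_principal_iff] at h'
  refine ⟨C, hC, ?_⟩
  filter_upwards [h', self_mem_nhdsWithin] with w hw hw0 T hT
  have := hw T hT
  have h3 : |w ^ 3| = w ^ 3 := abs_of_pos (pow_pos hw0 3)
  rwa [Real.norm_eq_abs, Real.norm_eq_abs, h3] at this

/-! ### Stopped chains and drift inequalities -/

open scoped ENNReal

/-- The update that freezes the state as soon as it reaches `[v, ∞)`. -/
def stopUpdate (H : ℝ × ℝ → ℝ) (v : ℝ) (q : ℝ × ℝ) : ℝ := if q.1 < v then H q else q.1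

lemma measurable_stopUpdate {H : ℝ × ℝ → ℝ} (hH : Measurable H) (v : ℝ) :
    Measurable (stopUpdate H v) :=
  Measurable.ite (measurableSet_lt measurable_fst measurable_const) hH measurable_fst

lemma stopUpdate_mem {H : ℝ × ℝ → ℝ} {S : Set ℝ} {v : ℝ} (hS : ∀ y ∈ S, ∀ b, H (y, b) ∈ S) :
    ∀ y ∈ S, ∀ b, stopUpdate H v (y, b) ∈ S := by
  intro y hy b
  unfold stopUpdate
  split_ifs
  · exact hS y hy b
  · exact hy

/-- Turns an event about the running maximum into one about the stopped chain at a single time. -/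
lemma chain_stopUpdate_lt_iff (H : ℝ × ℝ → ℝ) (x v : ℝ) (a : ℕ → ℝ) (n : ℕ) :
    chain (stopUpdate H v) x a n < v ↔ ∀ m ≤ n, chain H x a m < v := by
  have key : (chain (stopUpdate H v) x a n < v ∧
      chain (stopUpdate H v) x a n = chain H x a n ∧ ∀ m ≤ n, chain H x a m < v) ∨
      (v ≤ chain (stopUpdate H v) x a n ∧ ∃ m ≤ n, v ≤ chain H x a m) := by
    induction n with
    | zero =>
      rcases lt_or_ge x v with h | h
      · refine Or.inl ⟨h, rfl, fun m hm => ?_⟩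
        rw [Nat.le_zero.1 hm]
        exact h
      · exact Or.inr ⟨h, 0, le_rfl, h⟩
    | succ n ih =>
      rcases ih with ⟨h1, h2, h3⟩ | ⟨h1, m, hm, h2⟩
      · have h4 : chain (stopUpdate H v) x a (n + 1) = chain H x a (n + 1) := by
          rw [chain, stopUpdate, if_pos h1, h2, chain]
        rcases lt_or_ge (chain H x a (n + 1)) v with h | h
        · refine Or.inl ⟨h4 ▸ h, h4, fun m hm => ?_⟩
          rcases Nat.le_succ_iff.1 hm with h5 | rfl
          · exact h3 m h5
          · exact h
        · exact Or.inr ⟨h4 ▸ h, n + 1, le_rfl, h⟩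
      · refine Or.inr ⟨?_, m, hm.trans n.le_succ, h2⟩
        rw [chain, stopUpdate, if_neg (not_lt.2 h1)]
        exact h1
  rcases key with ⟨h1, -, h3⟩ | ⟨h1, m, hm, h2⟩
  · exact ⟨fun _ => h3, fun _ => h1⟩
  · exact ⟨fun h => absurd h (not_lt.2 h1), fun h => absurd (h m hm) (not_lt.2 h2)⟩

/-- The state at time `k` uses only the inputs before `k`, hence is independent of input `k`. -/
lemma exists_chain_eq {H : ℝ × ℝ → ℝ} (hH : Measurable H) (x : ℝ) (k : ℕ) :
    ∃ ψ : (Finset.range k → ℝ) → ℝ, Measurable ψ ∧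
      ∀ a : ℕ → ℝ, chain H x a k = ψ fun i => a i := by
  induction k with
  | zero => exact ⟨fun _ => x, measurable_const, fun _ => rfl⟩
  | succ k ih =>
    obtain ⟨ψ, hψ, h⟩ := ih
    refine ⟨fun y => H (ψ fun i => y ⟨i, Finset.mem_range.2
      ((Finset.mem_range.1 i.2).trans k.lt_succ_self)⟩, y ⟨k, Finset.self_mem_range_succ k⟩), ?_, ?_⟩
    · exact hH.comp ((hψ.comp (measurable_pi_lambda _ fun i => measurable_pi_apply _)).prodMk
        (measurable_pi_apply _))
    · intro a
      rw [chain, h]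

section Probability

variable {Ω : Type*} [MeasurableSpace Ω] {P : Measure Ω}
  {α : ℕ → Ω → ℝ} {μ : Measure ℝ} {H : ℝ × ℝ → ℝ}

lemma measurable_chain (hH : Measurable H) (hα : ∀ k, Measurable (α k)) (x : ℝ) (k : ℕ) :
    Measurable fun ω => chain H x (fun i => α i ω) k := by
  obtain ⟨ψ, hψ, h⟩ := exists_chain_eq hH x k
  simp only [h]
  exact hψ.comp (measurable_pi_lambda _ fun i => hα i)

lemma indepFun_chain (hH : Measurable H) (hα : ∀ k, Measurable (α k)) (hind : iIndepFun α P)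
    (x : ℝ) (k : ℕ) : IndepFun (fun ω => chain H x (fun i => α i ω) k) (α k) P := by
  obtain ⟨ψ, hψ, h⟩ := exists_chain_eq hH x k
  have h1 := hind.indepFun_finset (Finset.range k) {k} (by simp) hα
  have h2 := h1.comp hψ (measurable_pi_apply (⟨k, Finset.mem_singleton_self k⟩ : ({k} : Finset ℕ)))
  simp only [h]
  exact h2

variable [IsProbabilityMeasure P] [IsProbabilityMeasure μ]

/-- The Markov property in the form needed here: Fubini for the product law of the state and the
next input. -/
lemma lintegral_chain_succ (hH : Measurable H) (hα : ∀ k, Measurable (α k))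
    (hlaw : ∀ k, P.map (α k) = μ) (hind : iIndepFun α P) (x : ℝ) (k : ℕ) {f : ℝ → ℝ≥0∞}
    (hf : Measurable f) :
    ∫⁻ ω, f (chain H x (fun i => α i ω) (k + 1)) ∂P =
      ∫⁻ ω, ∫⁻ b, f (H (chain H x (fun i => α i ω) k, b)) ∂μ ∂P := by
  have hX := measurable_chain hH hα x k
  have h1 := (indepFun_iff_map_prod_eq_prod_map_map hX.aemeasurable (hα k).aemeasurable).1
    (indepFun_chain hH hα hind x k)
  have hfH : Measurable fun q => f (H q) := hf.comp hH
  calc ∫⁻ ω, f (chain H x (fun i => α i ω) (k + 1)) ∂P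
      = ∫⁻ q, f (H q) ∂(P.map fun ω => (chain H x (fun i => α i ω) k, α k ω)) := by
        rw [lintegral_map hfH (hX.prodMk (hα k))]
        rfl
    _ = _ := by
        rw [h1, hlaw, lintegral_prod _ hfH.aemeasurable,
          lintegral_map hfH.lintegral_prod_right' hX]

variable {S : Set ℝ} {x : ℝ} {f : ℝ → ℝ≥0∞}

lemma lintegral_stopped_le (hH : Measurable H) (hα : ∀ k, Measurable (α k))
    (hlaw : ∀ k, P.map (α k) = μ) (hind : iIndepFun α P) (hx : x ∈ S)
    (hS : ∀ y ∈ S, ∀ b, H (y, b) ∈ S) (hf : Measurable f) {C : ℝ≥0∞}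
    (hdrift : ∀ y ∈ S, ∫⁻ b, f (H (y, b)) ∂μ ≤ f y + C) (v : ℝ) (n : ℕ) :
    ∫⁻ ω, f (chain (stopUpdate H v) x (fun i => α i ω) n) ∂P ≤ f x + n * C := by
  induction n with
  | zero => simp [chain]
  | succ n ih =>
    rw [lintegral_chain_succ (measurable_stopUpdate hH v) hα hlaw hind x n hf]
    calc _ ≤ ∫⁻ ω, (f (chain (stopUpdate H v) x (fun i => α i ω) n) + C) ∂P := by
          refine lintegral_mono fun ω => ?_
          have hmem := chain_mem hx (stopUpdate_mem (v := v) hS) (fun i => α i ω) n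
          generalize chain (stopUpdate H v) x (fun i => α i ω) n = y at hmem ⊢
          by_cases hy : y < v
          · simpa [stopUpdate, hy] using hdrift y hmem
          · simp [stopUpdate, hy]
      _ = ∫⁻ ω, f (chain (stopUpdate H v) x (fun i => α i ω) n) ∂P + C := by
          rw [lintegral_add_right _ measurable_const]
          simp
      _ ≤ f x + n * C + C := add_le_add_left ih C
      _ = _ := by push_cast; ring

/-- Markov's inequality for `f` of the stopped chain, whose mean grows by at most `C` per step. -/
lemma measure_stopped_ge_mul_le (hH : Measurable H) (hα : ∀ k, Measurable (α k))
    (hlaw : ∀ k, P.map (α k) = μ) (hind : iIndepFun α P) (hx : x ∈ S)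
    (hS : ∀ y ∈ S, ∀ b, H (y, b) ∈ S) (hf : Measurable f) {C L : ℝ≥0∞}
    (hdrift : ∀ y ∈ S, ∫⁻ b, f (H (y, b)) ∂μ ≤ f y + C) {v : ℝ} (hL : ∀ y ∈ S, v ≤ y → L ≤ f y)
    (n : ℕ) :
    L * P {ω | v ≤ chain (stopUpdate H v) x (fun i => α i ω) n} ≤ f x + n * C := by
  refine le_trans ?_ (lintegral_stopped_le hH hα hlaw hind hx hS hf hdrift v n)
  refine le_trans ?_ (mul_meas_ge_le_lintegral
    (hf.comp (measurable_chain (measurable_stopUpdate hH v) hα x n)) L)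
  gcongr with ω
  exact fun hω => hL _ (chain_mem hx (stopUpdate_mem hS) _ _) hω

/-- Until stopping, each step adds at least `c` to the mean of `f`, whereas `f` of the stopped chain
never exceeds `M`, overshoot included. So the chain cannot remain unstopped for long with large
probability. -/
lemma nat_mul_measure_stopped_lt_le (hH : Measurable H) (hα : ∀ k, Measurable (α k))
    (hlaw : ∀ k, P.map (α k) = μ) (hind : iIndepFun α P) (hx : x ∈ S)
    (hS : ∀ y ∈ S, ∀ b, H (y, b) ∈ S) (hf : Measurable f) {c M : ℝ≥0∞}
    (hdrift : ∀ y ∈ S, f y + c ≤ ∫⁻ b, f (H (y, b)) ∂μ) {v : ℝ} (hxM : f x ≤ M)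
    (hM : ∀ y ∈ S, y < v → ∀ b, f (H (y, b)) ≤ M) (n : ℕ) :
    n * c * P {ω | chain (stopUpdate H v) x (fun i => α i ω) n < v} ≤ M := by
  have hms := fun n => measurable_chain (measurable_stopUpdate hH v) hα x n
  have hset : ∀ n, MeasurableSet {ω | chain (stopUpdate H v) x (fun i => α i ω) n < v} :=
    fun n => measurableSet_lt (hms n) measurable_const
  have hlow : n * c * P {ω | chain (stopUpdate H v) x (fun i => α i ω) n < v} ≤
      ∫⁻ ω, f (chain (stopUpdate H v) x (fun i => α i ω) n) ∂P := by
    induction n with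
    | zero => simp
    | succ n ih =>
      rw [lintegral_chain_succ (measurable_stopUpdate hH v) hα hlaw hind x n hf]
      have hsub : P {ω | chain (stopUpdate H v) x (fun i => α i ω) (n + 1) < v} ≤
          P {ω | chain (stopUpdate H v) x (fun i => α i ω) n < v} := by
        refine measure_mono fun ω hω => ?_
        simp only [Set.mem_ofPred_eq, chain_stopUpdate_lt_iff] at hω ⊢
        exact fun m hm => hω m (hm.trans n.le_succ)
      calc _ ≤ ((n + 1 : ℕ) : ℝ≥0∞) * c *
              P {ω | chain (stopUpdate H v) x (fun i => α i ω) n < v} := by gcongr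
        _ = n * c * P {ω | chain (stopUpdate H v) x (fun i => α i ω) n < v} +
              c * P {ω | chain (stopUpdate H v) x (fun i => α i ω) n < v} := by push_cast; ring
        _ ≤ ∫⁻ ω, f (chain (stopUpdate H v) x (fun i => α i ω) n) ∂P +
              ∫⁻ ω, {ω | chain (stopUpdate H v) x (fun i => α i ω) n < v}.indicator
                (fun _ => c) ω ∂P := by
            rw [lintegral_indicator_const (hset n)]
            gcongr
        _ = ∫⁻ ω, (f (chain (stopUpdate H v) x (fun i => α i ω) n) +
              {ω | chain (stopUpdate H v) x (fun i => α i ω) n < v}.indicator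
                (fun _ => c) ω) ∂P := (lintegral_add_left (hf.comp (hms n)) _).symm
        _ ≤ _ := by
            refine lintegral_mono fun ω => ?_
            have hmem := chain_mem hx (stopUpdate_mem (v := v) hS) (fun i => α i ω) n
            simp only [Set.indicator_apply, Set.mem_ofPred_eq]
            by_cases hy : chain (stopUpdate H v) x (fun i => α i ω) n < v
            · simpa [stopUpdate, hy] using hdrift _ hmem
            · simp [stopUpdate, hy]
  refine hlow.trans ?_
  have hbd : ∀ ω, f (chain (stopUpdate H v) x (fun i => α i ω) n) ≤ M := by
    intro ω
    have : chain (stopUpdate H v) x (fun i => α i ω) n ∈ S ∩ {y | f y ≤ M} := by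
      refine chain_mem (S := S ∩ {y | f y ≤ M}) ⟨hx, hxM⟩ ?_ _ _
      rintro y ⟨hy, hyM⟩ b
      refine ⟨stopUpdate_mem hS y hy b, ?_⟩
      unfold stopUpdate
      split_ifs with h
      · exact hM y hy h b
      · exact hyM
    exact this.2
  calc _ ≤ ∫⁻ _, M ∂P := lintegral_mono hbd
    _ = M := by simp

end Probability

/-! ### From tail bounds to almost sure bounds along dyadic blocks -/

section BorelCantelli

variable {Ω : Type*} [MeasurableSpace Ω] {P : Measure Ω} {M : ℕ → Ω → ℝ}

lemma eventually_of_dyadic {Q : ℕ → ℕ → Prop} (h : ∀ᶠ j in atTop, ∀ n : ℕ, 2 ^ (j + 1) ≤ n →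
    n < 2 ^ (j + 2) → Q j n) : ∀ᶠ n in atTop, ∃ j, Q j n := by
  obtain ⟨N, hN⟩ := eventually_atTop.1 h
  refine eventually_atTop.2 ⟨2 ^ (N + 1), fun n hn => ?_⟩
  have hn0 : n ≠ 0 := by
    rintro rfl
    exact absurd hn (not_le.2 (pow_pos two_pos _))
  have h1 : N + 1 ≤ Nat.log 2 n := Nat.le_log_of_pow_le one_lt_two hn
  obtain ⟨j, hj⟩ := Nat.exists_eq_add_of_le h1
  refine ⟨N + j, hN _ (Nat.le_add_right _ _) n ?_ ?_⟩
  · rw [show N + j + 1 = Nat.log 2 n by omega]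
    exact Nat.pow_log_le_self 2 hn0
  · rw [show N + j + 2 = (Nat.log 2 n).succ by omega]
    exact Nat.lt_pow_succ_log_self one_lt_two n

lemma summable_dyadic {s : ℝ} (hs : 1 < s) :
    Summable fun j : ℕ => (((j : ℝ) + 1) * Real.log 2) ^ (-s) := by
  have h1 : Summable fun j : ℕ => (((j + 1 : ℕ) : ℝ)) ^ (-s) :=
    (summable_nat_add_iff 1).2 (Real.summable_nat_rpow.2 (by linarith))
  refine (h1.mul_right (Real.log 2 ^ (-s))).congr fun j => ?_
  rw [← Real.mul_rpow (by positivity) (Real.log_nonneg one_le_two)]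
  push_cast
  rfl

lemma log_bound_of_dyadic {j n : ℕ} (h : 2 ^ (j + 1) ≤ n) :
    0 < ((j : ℝ) + 1) * Real.log 2 ∧ ((j : ℝ) + 1) * Real.log 2 ≤ Real.log n := by
  refine ⟨mul_pos (by positivity) (Real.log_pos one_lt_two), ?_⟩
  have h1 : ((2 : ℝ) ^ (j + 1)) ≤ n := by exact_mod_cast h
  have h2 := Real.log_le_log (by positivity) h1
  rw [Real.log_pow] at h2
  push_cast at h2
  exact h2

lemma ae_eventually_le_of_tail (hM : ∀ ω, Monotone fun n => M n ω) {κ C : ℝ} (hκ : 0 < κ)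
    (htail : ∀ n v, 0 < v → 1 ≤ n → P {ω | v ≤ M n ω} ≤ ENNReal.ofReal (C * n / v ^ κ))
    {ε : ℝ} (hε : 0 < ε) :
    ∀ᵐ ω ∂P, ∀ᶠ n : ℕ in atTop, M n ω ≤ (n : ℝ) ^ (1 / κ) * Real.log n ^ (1 / κ + ε) := by
  set l : ℕ → ℝ := fun j => ((j : ℝ) + 1) * Real.log 2 with hl
  have hl0 : ∀ j, 0 < l j := fun j => mul_pos (by positivity) (Real.log_pos one_lt_two)
  -- The claimed upper bound with `n` and `log n` replaced by their values at the left end of the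
  -- block `[2 ^ (j + 1), 2 ^ (j + 2))`. The maximum is taken at the right end, which costs only a
  -- factor `2`.
  set v : ℕ → ℝ := fun j => ((2 : ℝ) ^ (j + 1)) ^ (1 / κ) * l j ^ (1 / κ + ε) with hv
  have hv0 : ∀ j, 0 < v j := fun j => mul_pos (by positivity) (Real.rpow_pos_of_pos (hl0 j) _)
  have hvκ : ∀ j, v j ^ κ = 2 ^ (j + 1) * l j ^ (1 + ε * κ) := by
    intro j
    rw [hv]
    simp only
    rw [Real.mul_rpow (by positivity) (Real.rpow_nonneg (hl0 j).le _), ← Real.rpow_mul (by positivity),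
      ← Real.rpow_mul (hl0 j).le, one_div_mul_cancel hκ.ne', Real.rpow_one, add_mul,
      one_div_mul_cancel hκ.ne']
  have hsum : Summable fun j => 2 * C * l j ^ (-(1 + ε * κ)) :=
    (summable_dyadic (by nlinarith [mul_pos hε hκ])).mul_left _
  have hBC : ∑' j, P {ω | v j ≤ M (2 ^ (j + 2)) ω} ≠ ∞ := by
    refine ne_top_of_le_ne_top hsum.tsum_ofReal_ne_top (ENNReal.tsum_le_tsum fun j => ?_)
    refine (htail _ _ (hv0 j) Nat.one_le_two_pow).trans (ENNReal.ofReal_le_ofReal (le_of_eq ?_))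
    rw [hvκ, Real.rpow_neg (hl0 j).le]
    have := Real.rpow_pos_of_pos (hl0 j) (1 + ε * κ)
    push_cast
    field_simp
    ring
  filter_upwards [ae_eventually_notMem hBC] with ω hω
  have := eventually_of_dyadic (Q := fun _ n =>
    M n ω ≤ (n : ℝ) ^ (1 / κ) * Real.log n ^ (1 / κ + ε)) (hω.mono fun j hj n h1 h2 => ?_)
  · exact this.mono fun n ⟨_, h⟩ => h
  · rw [not_le] at hj
    obtain ⟨h3, h4⟩ := log_bound_of_dyadic h1
    have h5 : ((2 : ℝ) ^ (j + 1)) ≤ n := by exact_mod_cast h1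
    refine (hM ω h2.le).trans (hj.le.trans ?_)
    have h6 : 0 ≤ 1 / κ := by positivity
    exact mul_le_mul (Real.rpow_le_rpow (by positivity) h5 h6)
      (Real.rpow_le_rpow h3.le h4 (by linarith)) (Real.rpow_nonneg h3.le _)
      (Real.rpow_nonneg (by positivity) _)

lemma ae_eventually_ge_of_tail (hM : ∀ ω, Monotone fun n => M n ω) {κ C : ℝ} (hκ : 0 < κ)
    (htail : ∀ n v, 0 < v → 1 ≤ n → P {ω | M n ω < v} ≤ ENNReal.ofReal (C * (v ^ κ + 1) / n))
    {ε : ℝ} (hε : 0 < ε) :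
    ∀ᵐ ω ∂P, ∀ᶠ n : ℕ in atTop, (n : ℝ) ^ (1 / κ) * Real.log n ^ (-(1 / κ) - ε) ≤ M n ω := by
  set l : ℕ → ℝ := fun j => ((j : ℝ) + 1) * Real.log 2 with hl
  have hl0 : ∀ j, 0 < l j := fun j => mul_pos (by positivity) (Real.log_pos one_lt_two)
  -- Now the power of `n` is taken at the right end of the block and the decreasing power of the
  -- logarithm at the left end, so `v j` dominates the claimed lower bound on the whole block.
  set v : ℕ → ℝ := fun j => ((2 : ℝ) ^ (j + 2)) ^ (1 / κ) * l j ^ (-(1 / κ) - ε) with hv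
  have hv0 : ∀ j, 0 < v j := fun j => mul_pos (by positivity) (Real.rpow_pos_of_pos (hl0 j) _)
  have hvκ : ∀ j, v j ^ κ = 2 ^ (j + 2) * l j ^ (-(1 + ε * κ)) := by
    intro j
    rw [hv]
    simp only
    rw [Real.mul_rpow (by positivity) (Real.rpow_nonneg (hl0 j).le _), ← Real.rpow_mul (by positivity),
      ← Real.rpow_mul (hl0 j).le, one_div_mul_cancel hκ.ne', Real.rpow_one,
      show (-(1 / κ) - ε) * κ = -(1 / κ * κ + ε * κ) by ring, one_div_mul_cancel hκ.ne']
  have hsum : Summable fun j : ℕ => 2 * C * l j ^ (-(1 + ε * κ)) + C / 2 * (1 / 2) ^ j :=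
    ((summable_dyadic (by nlinarith [mul_pos hε hκ])).mul_left _).add
      (summable_geometric_two.mul_left _)
  have hBC : ∑' j, P {ω | M (2 ^ (j + 1)) ω < v j} ≠ ∞ := by
    refine ne_top_of_le_ne_top hsum.tsum_ofReal_ne_top (ENNReal.tsum_le_tsum fun j => ?_)
    refine (htail _ _ (hv0 j) Nat.one_le_two_pow).trans (ENNReal.ofReal_le_ofReal (le_of_eq ?_))
    rw [hvκ]
    push_cast
    rw [one_div, inv_pow]
    field_simp
    ring
  filter_upwards [ae_eventually_notMem hBC] with ω hω
  have := eventually_of_dyadic (Q := fun _ n =>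
    (n : ℝ) ^ (1 / κ) * Real.log n ^ (-(1 / κ) - ε) ≤ M n ω) (hω.mono fun j hj n h1 h2 => ?_)
  · exact this.mono fun n ⟨_, h⟩ => h
  · rw [not_lt] at hj
    obtain ⟨h3, h4⟩ := log_bound_of_dyadic h1
    have h5 : (n : ℝ) ≤ (2 : ℝ) ^ (j + 2) := by exact_mod_cast h2.le
    refine le_trans ?_ (hj.trans (hM ω h1))
    have h6 : 0 ≤ 1 / κ := by positivity
    exact mul_le_mul (Real.rpow_le_rpow (by positivity) h5 h6)
      (Real.rpow_le_rpow_of_nonpos h3 h4 (by linarith)) (Real.rpow_nonneg (h3.le.trans h4) _)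
      (Real.rpow_nonneg (by positivity) _)

end BorelCantelli

/-! ### Lyapunov functions and their drift -/

/-- The leading coefficient of the drift of `x ^ k` along the collisions, where `m` is the mean of
the squared tangent. -/
def driftCoeff (γ m k : ℝ) : ℝ := 2 * k * (γ * (1 + 2 * m) + (k - 1) * m)

section Drift

variable {γ K : ℝ} {μ : Measure ℝ} [IsProbabilityMeasure μ]

lemma integrable_tan (hK : ∀ᵐ a ∂μ, |Real.tan a| ≤ K) : Integrable Real.tan μ :=
  Integrable.of_bound measurable_real_tan.aestronglyMeasurable K hK

lemma integrable_tan_sq (hK : ∀ᵐ a ∂μ, |Real.tan a| ≤ K) :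
    Integrable (fun a => Real.tan a ^ 2) μ := by
  refine Integrable.of_bound (measurable_real_tan.pow_const 2).aestronglyMeasurable (K ^ 2)
    (hK.mono fun a ha => ?_)
  rw [norm_pow, Real.norm_eq_abs]
  gcongr

lemma integrable_one_add_relDisp_rpow (hγ : γ < 0) {k : ℝ} (hk : 0 ≤ k) (w : ℝ) :
    Integrable (fun a => (1 + relDisp γ K (w, Real.tan a)) ^ k) μ := by
  refine Integrable.of_bound (C := 2 ^ k) ?_ (Eventually.of_forall fun a => ?_)
  · exact ((measurable_const.add ((measurable_relDisp hγ K).comp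
      (measurable_const.prodMk measurable_real_tan))).pow_const _).aestronglyMeasurable
  · obtain ⟨h1, h2⟩ := relDisp_mem γ K (w, Real.tan a)
    rw [Real.norm_eq_abs, abs_of_nonneg (Real.rpow_nonneg (by linarith) _)]
    exact Real.rpow_le_rpow (by linarith) (by linarith) hk

lemma tendsto_rpow_sub_one (hγ : γ < 0) :
    Tendsto (fun x : ℝ => x ^ (γ - 1)) atTop (𝓝[>] 0) := by
  refine tendsto_nhdsWithin_iff.2 ⟨?_, ?_⟩
  · have := tendsto_rpow_neg_atTop (y := 1 - γ) (by linarith)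
    simpa using this
  · filter_upwards [eventually_gt_atTop 0] with x hx using Real.rpow_pos_of_pos hx _

/-- Integrate the expansion of `(1 + z) ^ k`: the term linear in the tangent has mean zero, and `x ^
k * w ^ 2` is the stated power of `x`. -/
lemma exists_integral_freeStep_rpow_bound (hγ : γ < 0) (hK : ∀ᵐ a ∂μ, |Real.tan a| ≤ K)
    (hodd : ∫ a, Real.tan a ∂μ = 0) {k : ℝ} (hk : 0 ≤ k) :
    ∃ C, 0 < C ∧ ∀ᶠ x in atTop, |∫ a, freeStep γ K x a ^ k ∂μ - x ^ k -
      driftCoeff γ (meanTanSq μ) k * x ^ (k - 2 + 2 * γ)| ≤ C * x ^ (k - 3 + 3 * γ) := by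
  obtain ⟨C, hC, h⟩ := exists_one_add_relDisp_rpow_bound hγ K k
  refine ⟨C, hC, ?_⟩
  filter_upwards [(tendsto_rpow_sub_one hγ).eventually h, eventually_gt_atTop 0] with x hx hx0
  set w := x ^ (γ - 1) with hw
  have hw2 : x ^ (k - 2 + 2 * γ) = x ^ k * w ^ 2 := by
    rw [hw, ← Real.rpow_natCast, ← Real.rpow_mul hx0.le, ← Real.rpow_add hx0]
    congr 1
    push_cast
    ring
  have hw3 : x ^ (k - 3 + 3 * γ) = x ^ k * w ^ 3 := by
    rw [hw, ← Real.rpow_natCast, ← Real.rpow_mul hx0.le, ← Real.rpow_add hx0]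
    congr 1
    push_cast
    ring
  have hU : ∀ a, freeStep γ K x a ^ k = x ^ k * (1 + relDisp γ K (w, Real.tan a)) ^ k := by
    intro a
    have := (relDisp_mem γ K (w, Real.tan a)).1
    rw [freeStep, Real.mul_rpow hx0.le (by linarith)]
  have hz := integrable_one_add_relDisp_rpow (K := K) (μ := μ) hγ hk w
  have hT := integrable_tan hK
  have hT2 := integrable_tan_sq hK
  have hint : ∫ a, ((1 + relDisp γ K (w, Real.tan a)) ^ k - 1 - 2 * k * (w * Real.tan a) -
      w ^ 2 * (2 * k * (γ * (1 + 2 * Real.tan a ^ 2) + (k - 1) * Real.tan a ^ 2))) ∂μ =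
      ∫ a, (1 + relDisp γ K (w, Real.tan a)) ^ k ∂μ - 1 -
        w ^ 2 * driftCoeff γ (meanTanSq μ) k := by
    have e : ∀ a, (1 + relDisp γ K (w, Real.tan a)) ^ k - 1 - 2 * k * (w * Real.tan a) -
        w ^ 2 * (2 * k * (γ * (1 + 2 * Real.tan a ^ 2) + (k - 1) * Real.tan a ^ 2)) =
        (1 + relDisp γ K (w, Real.tan a)) ^ k - (1 + w ^ 2 * (2 * k * γ)) -
          (2 * k * w) * Real.tan a -
          (w ^ 2 * (2 * k * (2 * γ + (k - 1)))) * Real.tan a ^ 2 := fun a => by ring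
    simp only [e]
    have i1 : Integrable (fun a => (1 + relDisp γ K (w, Real.tan a)) ^ k -
        (1 + w ^ 2 * (2 * k * γ))) μ := hz.sub (integrable_const _)
    have i2 : Integrable (fun a => (1 + relDisp γ K (w, Real.tan a)) ^ k -
        (1 + w ^ 2 * (2 * k * γ)) - (2 * k * w) * Real.tan a) μ := i1.sub (hT.const_mul _)
    rw [integral_sub i2 (hT2.const_mul _), integral_sub i1 (hT.const_mul _),
      integral_sub hz (integrable_const _), integral_const_mul, integral_const_mul, hodd]
    simp only [integral_const, probReal_univ, one_smul, driftCoeff, meanTanSq]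
    ring
  have hbd := norm_integral_le_of_norm_le_const (μ := μ) (C := C * w ^ 3)
    (f := fun a => (1 + relDisp γ K (w, Real.tan a)) ^ k - 1 - 2 * k * (w * Real.tan a) -
      w ^ 2 * (2 * k * (γ * (1 + 2 * Real.tan a ^ 2) + (k - 1) * Real.tan a ^ 2)))
    (hK.mono fun a ha => hx _ ha)
  rw [hint, probReal_univ, mul_one, Real.norm_eq_abs] at hbd
  simp only [hU, hw2, hw3]
  rw [integral_const_mul]
  have hxk := Real.rpow_pos_of_pos hx0 k
  calc _ = |x ^ k * (∫ a, (1 + relDisp γ K (w, Real.tan a)) ^ k ∂μ - 1 -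
        w ^ 2 * driftCoeff γ (meanTanSq μ) k)| := by
        congr 1
        ring
    _ = x ^ k * |∫ a, (1 + relDisp γ K (w, Real.tan a)) ^ k ∂μ - 1 -
        w ^ 2 * driftCoeff γ (meanTanSq μ) k| := by rw [abs_mul, abs_of_pos hxk]
    _ ≤ x ^ k * (C * w ^ 3) := mul_le_mul_of_nonneg_left hbd hxk.le
    _ = _ := by ring

/-- A Lyapunov function of order at least `x ^ κ` with drift bounded above. -/
def HasUpperDrift (γ K : ℝ) (μ : Measure ℝ) (κ : ℝ) : Prop :=
  ∃ f : ℝ → ℝ, Measurable f ∧ MonotoneOn f (Set.Ici 1) ∧ (∀ x, 1 ≤ x → x ^ κ ≤ f x) ∧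
    ∃ C, ∀ᶠ x in atTop, ∫ a, f (freeStep γ K x a) ∂μ ≤ f x + C

/-- A Lyapunov function of order at most `x ^ κ` with drift bounded below by a positive constant. -/
def HasLowerDrift (γ K : ℝ) (μ : Measure ℝ) (κ : ℝ) : Prop :=
  ∃ f : ℝ → ℝ, Measurable f ∧ MonotoneOn f (Set.Ici 1) ∧ (∀ x, 1 ≤ x → 0 ≤ f x ∧ f x ≤ x ^ κ) ∧
    ∃ c, 0 < c ∧ ∀ᶠ x in atTop, f x + c ≤ ∫ a, f (freeStep γ K x a) ∂μ

lemma eventually_mul_rpow_le (C : ℝ) {d b : ℝ} (hd : d < 0) (hb : 0 < b) :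
    ∀ᶠ x : ℝ in atTop, C * x ^ d ≤ b := by
  have h := (tendsto_rpow_neg_atTop (y := -d) (by linarith)).const_mul C
  rw [neg_neg, mul_zero] at h
  exact (h.eventually (gt_mem_nhds hb)).mono fun x hx => le_of_lt hx

lemma integrable_freeStep_rpow (hγ : γ < 0) {k x : ℝ} (hk : 0 ≤ k) (hx : 0 ≤ x) :
    Integrable (fun a => freeStep γ K x a ^ k) μ := by
  refine ((integrable_one_add_relDisp_rpow (K := K) (μ := μ) hγ hk (x ^ (γ - 1))).const_mul
    (x ^ k)).congr (Eventually.of_forall fun a => ?_)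
  have := (relDisp_mem γ K (x ^ (γ - 1), Real.tan a)).1
  simp only [freeStep]
  rw [Real.mul_rpow hx (by linarith)]

lemma monotoneOn_rpow_Ici {k : ℝ} (hk : 0 ≤ k) : MonotoneOn (fun x : ℝ => x ^ k) (Set.Ici 1) :=
  fun _ hx _ _ hxy => Real.rpow_le_rpow (zero_le_one.trans hx) hxy hk

/-- For this power the main term of the drift is constant and the error is of order `x ^ (γ - 1)`,
so one function serves both directions. -/
lemma hasDrift_of_driftCoeff_pos (hγ : γ < 0) (hK : ∀ᵐ a ∂μ, |Real.tan a| ≤ K)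
    (hodd : ∫ a, Real.tan a ∂μ = 0)
    (hq : 0 < driftCoeff γ (meanTanSq μ) (2 * (1 - γ))) :
    HasUpperDrift γ K μ (2 * (1 - γ)) ∧ HasLowerDrift γ K μ (2 * (1 - γ)) := by
  have hk : 0 ≤ 2 * (1 - γ) := by linarith
  obtain ⟨C, hC, h⟩ := exists_integral_freeStep_rpow_bound hγ hK hodd hk
  set q := driftCoeff γ (meanTanSq μ) (2 * (1 - γ))
  have h' : ∀ᶠ x in atTop,
      |∫ a, freeStep γ K x a ^ (2 * (1 - γ)) ∂μ - x ^ (2 * (1 - γ)) - q| ≤ q / 2 := by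
    filter_upwards [h, eventually_mul_rpow_le C (d := 2 * (1 - γ) - 3 + 3 * γ) (by linarith)
      (half_pos hq)] with x hx hx2
    rw [show 2 * (1 - γ) - 2 + 2 * γ = 0 by ring, Real.rpow_zero, mul_one] at hx
    exact hx.trans hx2
  refine ⟨⟨fun x => x ^ (2 * (1 - γ)), by fun_prop, monotoneOn_rpow_Ici hk, fun _ _ => le_rfl,
    2 * q, ?_⟩, ⟨fun x => x ^ (2 * (1 - γ)), by fun_prop, monotoneOn_rpow_Ici hk,
    fun x hx => ⟨Real.rpow_nonneg (by linarith) _, le_rfl⟩, q / 2, half_pos hq, ?_⟩⟩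
  · filter_upwards [h'] with x hx
    have := (abs_le.1 hx).2
    linarith
  · filter_upwards [h'] with x hx
    have := (abs_le.1 hx).1
    linarith

/-- At a root the drift of `x ^ κ` is only `O(x ^ (κ - 3 + 3γ))`. Since `η < 1 - γ`, the negative
drift of `x ^ (κ - η)` dominates this: adding that power gives nonpositive drift far out,
subtracting it gives positive drift, bounded away from zero because `η ≤ κ - 2 + 2γ`. -/
lemma hasDrift_of_driftCoeff_eq_zero (hγ : γ < 0) (hK : ∀ᵐ a ∂μ, |Real.tan a| ≤ K)
    (hodd : ∫ a, Real.tan a ∂μ = 0) {κ η : ℝ} (hη : 0 < η) (hη1 : η < 1 - γ)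
    (hηκ : η ≤ κ - 2 + 2 * γ) (hq : driftCoeff γ (meanTanSq μ) κ = 0)
    (hq' : driftCoeff γ (meanTanSq μ) (κ - η) < 0) :
    HasUpperDrift γ K μ κ ∧ HasLowerDrift γ K μ κ := by
  have hk' : 0 ≤ κ - η := by linarith
  have hk : 0 ≤ κ := by linarith
  obtain ⟨C, hC, h⟩ := exists_integral_freeStep_rpow_bound hγ hK hodd hk
  obtain ⟨C', hC', h'⟩ := exists_integral_freeStep_rpow_bound hγ hK hodd hk'
  set q := driftCoeff γ (meanTanSq μ) (κ - η)
  have hA : ∀ᶠ x in atTop, |∫ a, freeStep γ K x a ^ κ ∂μ - x ^ κ| ≤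
      -q / 4 * x ^ (κ - η - 2 + 2 * γ) := by
    filter_upwards [h, eventually_mul_rpow_le C (d := η - 1 + γ) (b := -q / 4) (by linarith)
      (by linarith), eventually_gt_atTop 0] with x hx hx2 hx0
    rw [hq, zero_mul, sub_zero] at hx
    refine hx.trans ?_
    rw [show κ - 3 + 3 * γ = (η - 1 + γ) + (κ - η - 2 + 2 * γ) by ring, Real.rpow_add hx0,
      ← mul_assoc]
    exact mul_le_mul_of_nonneg_right hx2 (Real.rpow_nonneg hx0.le _)
  have hB : ∀ᶠ x in atTop, ∫ a, freeStep γ K x a ^ (κ - η) ∂μ - x ^ (κ - η) ≤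
      q / 2 * x ^ (κ - η - 2 + 2 * γ) := by
    filter_upwards [h', eventually_mul_rpow_le C' (d := -1 + γ) (b := -q / 2) (by linarith)
      (by linarith), eventually_gt_atTop 0] with x hx hx2 hx0
    have h0 : C' * x ^ (κ - η - 3 + 3 * γ) =
        C' * x ^ (-1 + γ) * x ^ (κ - η - 2 + 2 * γ) := by
      rw [mul_assoc, ← Real.rpow_add hx0]
      congr 2
      ring
    rw [h0] at hx
    have h1 := mul_le_mul_of_nonneg_right hx2 (Real.rpow_nonneg hx0.le (κ - η - 2 + 2 * γ))
    have h2 := (abs_le.1 (hx.trans h1)).2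
    linarith
  have hsum : ∀ x : ℝ, 0 ≤ x → ∀ b : ℝ,
      ∫ a, (freeStep γ K x a ^ κ + b * freeStep γ K x a ^ (κ - η)) ∂μ =
      ∫ a, freeStep γ K x a ^ κ ∂μ + b * ∫ a, freeStep γ K x a ^ (κ - η) ∂μ := by
    intro x hx b
    rw [integral_add (integrable_freeStep_rpow hγ hk hx)
      ((integrable_freeStep_rpow hγ hk' hx).const_mul b), integral_const_mul]
  constructor
  · refine ⟨fun x => x ^ κ + 1 * x ^ (κ - η), by fun_prop, ?_, ?_, 0, ?_⟩
    · simpa using (monotoneOn_rpow_Ici hk).add (monotoneOn_rpow_Ici hk')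
    · intro x hx
      have := Real.rpow_nonneg (by linarith : 0 ≤ x) (κ - η)
      linarith
    · filter_upwards [hA, hB, eventually_ge_atTop 0] with x hx1 hx2 hx0
      rw [hsum x hx0]
      have := (abs_le.1 hx1).2
      have h0 := mul_nonneg (by linarith : 0 ≤ -q) (Real.rpow_nonneg hx0 (κ - η - 2 + 2 * γ))
      linarith
  · have hfac : ∀ x : ℝ, 1 ≤ x →
        x ^ κ + (-1) * x ^ (κ - η) = x ^ (κ - η) * (x ^ η - 1) := by
      intro x hx
      rw [mul_sub, ← Real.rpow_add (by linarith), sub_add_cancel]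
      ring
    have hη0 : ∀ x : ℝ, 1 ≤ x → 0 ≤ x ^ η - 1 := fun x hx =>
      sub_nonneg.2 (Real.one_le_rpow hx hη.le)
    refine ⟨fun x => x ^ κ + (-1) * x ^ (κ - η), by fun_prop, ?_, ?_, -q / 4, by linarith, ?_⟩
    · intro x hx y hy hxy
      simp only
      rw [hfac x hx, hfac y hy]
      have h0 : (0 : ℝ) ≤ x := zero_le_one.trans hx
      exact mul_le_mul (Real.rpow_le_rpow h0 hxy hk')
        (sub_le_sub_right (Real.rpow_le_rpow h0 hxy hη.le) 1) (hη0 x hx)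
        (Real.rpow_nonneg (h0.trans hxy) _)
    · intro x hx
      have := Real.rpow_nonneg (by linarith : 0 ≤ x) (κ - η)
      refine ⟨?_, by linarith⟩
      change 0 ≤ x ^ κ + -1 * x ^ (κ - η)
      rw [hfac x hx]
      exact mul_nonneg this (hη0 x hx)
    · filter_upwards [hA, hB, eventually_ge_atTop 1] with x hx1 hx2 hx0
      rw [hsum x (by linarith)]
      have := (abs_le.1 hx1).1
      have h0 := mul_le_mul_of_nonneg_left (Real.one_le_rpow hx0
        (by linarith : 0 ≤ κ - η - 2 + 2 * γ)) (by linarith : 0 ≤ -q / 4)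
      linarith

end Drift

/-! ### Tails of the running maximum -/

/-- The running maximum of the horizontal coordinates. -/
def maxAbscissa (γ K A x : ℝ) (a : ℕ → ℝ) (n : ℕ) : ℝ :=
  (Finset.range (n + 1)).sup' Finset.nonempty_range_add_one fun m => abscissa γ K A x a m

lemma monotone_maxAbscissa (γ K A x : ℝ) (a : ℕ → ℝ) : Monotone (maxAbscissa γ K A x a) :=
  fun _ _ hmn => Finset.sup'_mono _ (Finset.range_mono (Nat.succ_le_succ hmn)) _

lemma maxAbscissa_lt_iff {γ K A x v : ℝ} {a : ℕ → ℝ} {n : ℕ} :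
    maxAbscissa γ K A x a n < v ↔
      chain (stopUpdate (fun q => nextAbscissa γ K A q.1 q.2) v) x a n < v := by
  rw [chain_stopUpdate_lt_iff, maxAbscissa, Finset.sup'_lt_iff]
  simp only [Finset.mem_range, Nat.lt_succ_iff]
  rfl

section Tails

variable {γ K κ A x : ℝ} {μ : Measure ℝ} [IsProbabilityMeasure μ] {f : ℝ → ℝ}

lemma lintegral_ofReal_freeStep (hγ : γ < 0) (hf : Measurable f)
    (hmono : MonotoneOn f (Set.Ici 1)) (h0 : ∀ x, 1 ≤ x → 0 ≤ f x) (hx : 2 ≤ x) :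
    ∫⁻ a, ENNReal.ofReal (f (freeStep γ K x a)) ∂μ =
      ENNReal.ofReal (∫ a, f (freeStep γ K x a) ∂μ) := by
  have h1 : ∀ a, 1 ≤ freeStep γ K x a := fun a => by
    linarith [freeStep_ge (γ := γ) (K := K) (by linarith : 0 ≤ x) a]
  refine (ofReal_integral_eq_lintegral_ofReal ?_ (Eventually.of_forall fun a => h0 _ (h1 a))).symm
  refine Integrable.of_bound (C := f (2 * x)) ?_ (Eventually.of_forall fun a => ?_)
  · exact (hf.comp ((measurable_freeStep hγ K).comp
      (measurable_const.prodMk measurable_id))).aestronglyMeasurable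
  · rw [Real.norm_eq_abs, abs_of_nonneg (h0 _ (h1 a))]
    have h2 : (1 : ℝ) ≤ 2 * x := by linarith
    exact hmono (h1 a) h2 (freeStep_le (by linarith) a)

variable {Ω : Type*} [MeasurableSpace Ω] {P : Measure Ω} [IsProbabilityMeasure P]
  {α : ℕ → Ω → ℝ}

lemma exists_upper_tail (hγ : γ < 0) (hκ : 0 < κ) (hA : 2 ≤ A) (hx : A < x)
    (hf : Measurable f) (hmono : MonotoneOn f (Set.Ici 1)) (hge : ∀ x, 1 ≤ x → x ^ κ ≤ f x)
    {C : ℝ} (hdrift : ∀ y, A < y → ∫ a, f (freeStep γ K y a) ∂μ ≤ f y + C)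
    (hα : ∀ k, Measurable (α k)) (hlaw : ∀ k, P.map (α k) = μ) (hind : iIndepFun α P) :
    ∃ C', ∀ n v, 0 < v → 1 ≤ n → P {ω | v ≤ maxAbscissa γ K A x (fun i => α i ω) n} ≤
      ENNReal.ofReal (C' * n / v ^ κ) := by
  have h0 : ∀ x, 1 ≤ x → 0 ≤ f x := fun x hx =>
    (Real.rpow_nonneg (by linarith) κ).trans (hge x hx)
  have hfA : 0 ≤ f (4 * A) := h0 _ (by linarith)
  have hfx : 0 ≤ f x := h0 _ (by linarith)
  -- Beyond `2 * A` no reset can occur, as a free step at most halves the abscissa. From at most `2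
  -- * A` the next abscissa is at most `4 * A`, so `f (4 * A)` covers that case.
  set C₁ := |C| + f (4 * A) with hC₁
  have hC₁0 : 0 ≤ C₁ := by positivity
  refine ⟨f x + C₁, fun n v hv hn => ?_⟩
  have hdrift' : ∀ y ∈ Set.Ioi A, ∫⁻ b, ENNReal.ofReal (f (nextAbscissa γ K A y b)) ∂μ ≤
      ENNReal.ofReal (f y) + ENNReal.ofReal C₁ := by
    intro y hy
    have hy' : A < y := hy
    rw [← ENNReal.ofReal_add (h0 _ (by linarith)) hC₁0]
    rcases lt_or_ge (2 * A) y with h2 | h2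
    · have heq : ∀ b, nextAbscissa γ K A y b = freeStep γ K y b := fun b => if_pos (by
        linarith [freeStep_ge (γ := γ) (K := K) (by linarith : 0 ≤ y) b])
      simp only [heq]
      rw [lintegral_ofReal_freeStep hγ hf hmono h0 (by linarith)]
      refine ENNReal.ofReal_le_ofReal ((hdrift y hy).trans ?_)
      linarith [le_abs_self C]
    · calc _ ≤ ∫⁻ _, ENNReal.ofReal (f (4 * A)) ∂μ := by
            refine lintegral_mono fun b => ENNReal.ofReal_le_ofReal ?_
            have h3 := lt_nextAbscissa (γ := γ) (K := K) (x := y) (a := b)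
              (by linarith : 0 < A)
            have h4 := nextAbscissa_le (γ := γ) (K := K) (a := b) (by linarith : 0 < A) hy'.le
            have h5 : (1 : ℝ) ≤ nextAbscissa γ K A y b := by linarith
            have h6 : (1 : ℝ) ≤ 4 * A := by linarith
            exact hmono h5 h6 (by linarith)
        _ = ENNReal.ofReal (f (4 * A)) := by simp
        _ ≤ _ := ENNReal.ofReal_le_ofReal (by
            linarith [abs_nonneg C, h0 y (by linarith)])
  have key := measure_stopped_ge_mul_le (f := fun y => ENNReal.ofReal (f y)) (v := v)
    (L := ENNReal.ofReal (v ^ κ))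
    (measurable_nextAbscissa hγ K A) hα hlaw hind hx
    (fun _ _ _ => lt_nextAbscissa (by linarith : 0 < A)) hf.ennreal_ofReal hdrift'
    (fun y hy hvy => ENNReal.ofReal_le_ofReal
      ((Real.rpow_le_rpow hv.le hvy hκ.le).trans (hge y (by
        have : A < y := hy
        linarith)))) n
  have hset : {ω | v ≤ maxAbscissa γ K A x (fun i => α i ω) n} =
      {ω | v ≤ chain (stopUpdate (fun q => nextAbscissa γ K A q.1 q.2) v) x
        (fun i => α i ω) n} :=
    Set.ext fun ω => not_lt.symm.trans ((not_congr maxAbscissa_lt_iff).trans not_lt)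
  rw [hset]
  have hvκ := Real.rpow_pos_of_pos hv κ
  rw [ENNReal.ofReal_div_of_pos hvκ, ENNReal.le_div_iff_mul_le
    (Or.inl (ENNReal.ofReal_pos.2 hvκ).ne') (Or.inl ENNReal.ofReal_ne_top), mul_comm]
  refine key.trans ?_
  rw [← ENNReal.ofReal_natCast, ← ENNReal.ofReal_mul (by positivity),
    ← ENNReal.ofReal_add hfx (by positivity)]
  refine ENNReal.ofReal_le_ofReal ?_
  have hn' : (1 : ℝ) ≤ n := by exact_mod_cast hn
  nlinarith

lemma exists_lower_tail (hγ : γ < 0) (hκ : 0 < κ) (hA : 2 ≤ A) (hx : A < x)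
    (hf : Measurable f) (hmono : MonotoneOn f (Set.Ici 1))
    (hle : ∀ x, 1 ≤ x → 0 ≤ f x ∧ f x ≤ x ^ κ) {c : ℝ} (hc : 0 < c)
    (hdrift : ∀ y, A < y → f y + c ≤ ∫ a, f (freeStep γ K y a) ∂μ)
    (hα : ∀ k, Measurable (α k)) (hlaw : ∀ k, P.map (α k) = μ) (hind : iIndepFun α P) :
    ∃ C', ∀ n v, 0 < v → 1 ≤ n → P {ω | maxAbscissa γ K A x (fun i => α i ω) n < v} ≤
      ENNReal.ofReal (C' * (v ^ κ + 1) / n) := by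
  refine ⟨(x ^ κ + 2 ^ κ) / c, fun n v hv hn => ?_⟩
  have hxκ := Real.rpow_nonneg (by linarith : 0 ≤ x) κ
  have hvκ := Real.rpow_nonneg hv.le κ
  have h2κ := Real.rpow_nonneg zero_le_two κ
  have hdrift' : ∀ y ∈ Set.Ioi A, ENNReal.ofReal (f y) + ENNReal.ofReal c ≤
      ∫⁻ b, ENNReal.ofReal (f (nextAbscissa γ K A y b)) ∂μ := by
    intro y hy
    have hy' : A < y := hy
    rw [← ENNReal.ofReal_add (hle _ (by linarith)).1 hc.le]
    refine (ENNReal.ofReal_le_ofReal (hdrift y hy)).trans ?_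
    rw [← lintegral_ofReal_freeStep hγ hf hmono (fun x hx => (hle x hx).1) (by linarith)]
    refine lintegral_mono fun b => ENNReal.ofReal_le_ofReal ?_
    have h1 : 1 ≤ freeStep γ K y b := by
      linarith [freeStep_ge (γ := γ) (K := K) (by linarith : 0 ≤ y) b]
    -- A reset only moves the particle to the right, so it preserves a lower drift bound for an
    -- increasing `f`.
    have h2 : freeStep γ K y b ≤ nextAbscissa γ K A y b := by
      unfold nextAbscissa
      split_ifs with h
      · exact le_rfl
      · linarith
    exact hmono h1 (h1.trans h2) h2
  have key := nat_mul_measure_stopped_lt_le (f := fun y => ENNReal.ofReal (f y)) (v := v)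
    -- The first term covers the starting value, the second a step from below `v`, which ends below
    -- `2 * v`.
    (M := ENNReal.ofReal (x ^ κ + (2 * v) ^ κ))
    (measurable_nextAbscissa hγ K A) hα hlaw hind hx
    (fun _ _ _ => lt_nextAbscissa (by linarith : 0 < A)) hf.ennreal_ofReal hdrift' ?_ ?_ n
  · simp only [maxAbscissa_lt_iff]
    have hn' : (0 : ℝ) < n := by exact_mod_cast hn
    have hcn : 0 < n * c := mul_pos hn' hc
    rw [← ENNReal.ofReal_natCast, ← ENNReal.ofReal_mul hn'.le, mul_comm,
      ← ENNReal.le_div_iff_mul_le (Or.inl (ENNReal.ofReal_pos.2 hcn).ne')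
        (Or.inl ENNReal.ofReal_ne_top), ← ENNReal.ofReal_div_of_pos hcn] at key
    refine key.trans (ENNReal.ofReal_le_ofReal ?_)
    rw [Real.mul_rpow zero_le_two hv.le, div_mul_eq_mul_div, div_div, mul_comm c]
    gcongr
    nlinarith [mul_nonneg hxκ hvκ]
  · refine ENNReal.ofReal_le_ofReal ((hle x (by linarith)).2.trans ?_)
    linarith [Real.rpow_nonneg (by linarith : 0 ≤ 2 * v) κ]
  · intro y hy hyv b
    have hy' : A < y := hy
    have h3 := lt_nextAbscissa (γ := γ) (K := K) (x := y) (a := b) (by linarith : 0 < A)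
    have h4 := nextAbscissa_le (γ := γ) (K := K) (a := b) (by linarith : 0 < A) hy'.le
    refine ENNReal.ofReal_le_ofReal ((hle _ (by linarith)).2.trans ?_)
    have := Real.rpow_le_rpow (by linarith) (h4.trans (by linarith : 2 * y ≤ 2 * v)) hκ.le
    linarith

end Tails

/-- Almost sure growth of the running maximum with exponent `1 / κ`, for far away tubes. -/
lemma exists_forall_maxAbscissa_growth {γ K κ : ℝ} {μ : Measure ℝ} [IsProbabilityMeasure μ]
    (hγ : γ < 0) (hκ : 0 < κ) (hup : HasUpperDrift γ K μ κ) (hlow : HasLowerDrift γ K μ κ) :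
    ∃ A₀ : ℝ, ∀ A, A₀ < A → ∀ x, A < x →
      ∀ (Ω : Type*) [MeasurableSpace Ω] (P : Measure Ω) [IsProbabilityMeasure P]
        (α : ℕ → Ω → ℝ), (∀ k, Measurable (α k)) → (∀ k, P.map (α k) = μ) → iIndepFun α P →
        ∀ ε : ℝ, 0 < ε → ∀ᵐ ω ∂P, ∀ᶠ n : ℕ in atTop,
          maxAbscissa γ K A x (fun k => α k ω) n
              ≤ (n : ℝ) ^ (1 / κ) * Real.log n ^ (1 / κ + ε) ∧
          (n : ℝ) ^ (1 / κ) * Real.log n ^ (-(1 / κ) - ε)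
              ≤ maxAbscissa γ K A x (fun k => α k ω) n := by
  obtain ⟨f, hf, hmono, hge, C, hC⟩ := hup
  obtain ⟨g, hg, hgmono, hle, c, hc, hgc⟩ := hlow
  obtain ⟨A₁, hA₁⟩ := eventually_atTop.1 (hC.and hgc)
  refine ⟨max A₁ 2, fun A hA x hx Ω _ P _ α hα hlaw hind ε hε => ?_⟩
  have hA2 : 2 ≤ A := (le_max_right _ _).trans hA.le
  have hA1 : ∀ y, A < y → A₁ ≤ y := fun y hy => ((le_max_left _ _).trans hA.le).trans hy.le
  obtain ⟨C₁, h₁⟩ := exists_upper_tail hγ hκ hA2 hx hf hmono hge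
    (fun y hy => (hA₁ y (hA1 y hy)).1) hα hlaw hind
  obtain ⟨C₂, h₂⟩ := exists_lower_tail hγ hκ hA2 hx hg hgmono hle hc
    (fun y hy => (hA₁ y (hA1 y hy)).2) hα hlaw hind
  filter_upwards [ae_eventually_le_of_tail (fun ω => monotone_maxAbscissa _ _ _ _ _) hκ h₁ hε,
    ae_eventually_ge_of_tail (fun ω => monotone_maxAbscissa _ _ _ _ _) hκ h₂ hε] with ω h3 h4
  exact h3.and h4

lemma runningMax_eq {γ K A : ℝ} {p : ℝ × ℝ} {a : ℕ → ℝ}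
    (h : ∀ k, ∃ σ : ℝ, (σ = 1 ∨ σ = -1) ∧ collisions (fun x => x ^ γ) A p a k =
      some (abscissa γ K A p.1 a k, σ * abscissa γ K A p.1 a k ^ γ)) (n : ℕ) :
    runningMax (fun x => x ^ γ) A p a n = maxAbscissa γ K A p.1 a n := by
  unfold runningMax maxAbscissa
  congr 1
  funext m
  obtain ⟨σ, -, hσ⟩ := h m
  rw [hσ]
  rfl

/-! ### Moments of the tangent of the angle -/

section AngleLaw

variable {μ : Measure ℝ} [IsProbabilityMeasure μ] {α₀ : ℝ}

lemma abs_tan_le_of_abs_lt (hα₀ : α₀ < Real.pi / 2) {a : ℝ} (ha : |a| < α₀) :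
    0 < Real.cos a ∧ |Real.tan a| ≤ Real.tan α₀ := by
  obtain ⟨h1, h2⟩ := abs_lt.1 ha
  have hm : ∀ {b : ℝ}, |b| ≤ α₀ → b ∈ Set.Ioo (-(Real.pi / 2)) (Real.pi / 2) := fun hb =>
    ⟨by linarith [(abs_le.1 hb).1], by linarith [(abs_le.1 hb).2]⟩
  have h0 : |α₀| ≤ α₀ := (abs_of_nonneg ((abs_nonneg a).trans ha.le)).le
  refine ⟨Real.cos_pos_of_mem_Ioo (hm ha.le), abs_le.2 ⟨?_, ?_⟩⟩
  · rw [← Real.tan_neg]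
    exact (Real.strictMonoOn_tan.le_iff_le (hm (by rwa [abs_neg])) (hm ha.le)).2 h1.le
  · exact (Real.strictMonoOn_tan.le_iff_le (hm ha.le) (hm h0)).2 h2.le

lemma integral_tan_eq_zero (hsymm : ∀ x : ℝ, μ (Set.Ici x) = μ (Set.Iic (-x))) :
    ∫ a, Real.tan a ∂μ = 0 := by
  have h1 : μ.map (fun a => -a) = μ := by
    refine Measure.ext_of_Iic _ _ fun a => ?_
    rw [Measure.map_apply measurable_neg measurableSet_Iic]
    have := hsymm (-a)
    rw [neg_neg] at this
    rw [← this]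
    congr 1
    ext b
    simp only [Set.mem_preimage, Set.mem_Iic, Set.mem_Ici]
    exact neg_le
  have h2 : ∫ a, Real.tan a ∂μ = ∫ a, Real.tan (-a) ∂μ := by
    conv_lhs => rw [← h1]
    exact integral_map measurable_neg.aemeasurable measurable_real_tan.aestronglyMeasurable
  simp only [Real.tan_neg, integral_neg] at h2
  linarith

/-- A vanishing second moment would force the tangent, hence the angle, to be zero almost surely. -/
lemma meanTanSq_pos (hα₀ : α₀ < Real.pi / 2) (hbdd : ∀ᵐ a ∂μ, |a| < α₀)
    (hnondeg : ¬ ∃ c : ℝ, ∀ᵐ a ∂μ, a = c) : 0 < meanTanSq μ := by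
  refine lt_of_le_of_ne (integral_nonneg fun a => sq_nonneg _) fun h => hnondeg ⟨0, ?_⟩
  have hint := integrable_tan_sq (hbdd.mono fun a ha => (abs_tan_le_of_abs_lt hα₀ ha).2)
  have h0 := (integral_eq_zero_iff_of_nonneg (fun a => sq_nonneg _) hint).1 h.symm
  filter_upwards [h0, hbdd] with a ha hb
  obtain ⟨h1, h2⟩ := abs_lt.1 hb
  have hpi := Real.pi_pos
  exact Real.strictMonoOn_tan.injOn ⟨by linarith, by linarith⟩ ⟨by linarith, by linarith⟩
    ((pow_eq_zero_iff two_ne_zero).1 ha |>.trans Real.tan_zero.symm)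

end AngleLaw

end

end StochasticBilliard
-- The two regimes
open StochasticBilliard in
theorem mainTheorem8 (γ : ℝ) (hγ : γ < 0)
    (μ : Measure ℝ) [IsProbabilityMeasure μ]
    (α₀ : ℝ) (hα₀ : α₀ ∈ Set.Ioo 0 (Real.pi / 2))
    (hbdd : ∀ᵐ a ∂μ, |a| < α₀)
    (hsymm : ∀ x : ℝ, μ (Set.Ici x) = μ (Set.Iic (-x)))
    (hnondeg : ¬ ∃ c : ℝ, ∀ᵐ a ∂μ, a = c) :
    ∃ A₀ : ℝ, ∀ A : ℝ, 1 ≤ A → A₀ < A →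
      ∀ p : ℝ × ℝ, p ∈ frontier (tube (fun x => x ^ γ) A) → 2 * A < p.1 →
      ∀ (Ω : Type*) [MeasurableSpace Ω] (P : Measure Ω) [IsProbabilityMeasure P]
        (α : ℕ → Ω → ℝ), (∀ k, Measurable (α k)) → (∀ k, P.map (α k) = μ) → iIndepFun α P →
        (∀ᵐ ω ∂P, ∀ n, collisions (fun x => x ^ γ) A p (fun k => α k ω) n ≠ none) ∧
        (-meanTanSq μ < γ → ∀ ε : ℝ, 0 < ε → ∀ᵐ ω ∂P, ∀ᶠ n : ℕ in atTop,
          runningMax (fun x => x ^ γ) A p (fun k => α k ω) n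
              ≤ (n : ℝ) ^ (1 / (2 * (1 - γ))) * Real.log n ^ (1 / (2 * (1 - γ)) + ε) ∧
          (n : ℝ) ^ (1 / (2 * (1 - γ))) * Real.log n ^ (-(1 / (2 * (1 - γ))) - ε)
              ≤ runningMax (fun x => x ^ γ) A p (fun k => α k ω) n) ∧
        (γ < -meanTanSq μ → ∀ ε : ℝ, 0 < ε → ∀ᵐ ω ∂P, ∀ᶠ n : ℕ in atTop,
          runningMax (fun x => x ^ γ) A p (fun k => α k ω) n
              ≤ (n : ℝ) ^ rho μ γ * Real.log n ^ (2 * rho μ γ + ε) ∧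
          (n : ℝ) ^ rho μ γ * Real.log n ^ (-(2 * rho μ γ) - ε)
              ≤ runningMax (fun x => x ^ γ) A p (fun k => α k ω) n) := by
  set K := Real.tan α₀ with hKdef
  have hK : ∀ᵐ a ∂μ, |Real.tan a| ≤ K := hbdd.mono fun a ha => (abs_tan_le_of_abs_lt hα₀.2 ha).2
  have hodd := integral_tan_eq_zero hsymm
  have hm := meanTanSq_pos hα₀.2 hbdd hnondeg
  set m := meanTanSq μ
  obtain ⟨A₁, h₁⟩ := eventually_atTop.1 ((tendsto_rpow_sub_one hγ).eventually
    (eventually_isNarrow γ K))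
  have hκ : 0 < 2 * (1 - γ) := by linarith
  have hρ : 0 < rho μ γ := div_pos hm (by change 0 < (1 - 2 * γ) * m - γ; nlinarith)
  have hlarge : -m < γ → HasUpperDrift γ K μ (2 * (1 - γ)) ∧ HasLowerDrift γ K μ (2 * (1 - γ)) := by
    intro hmγ
    refine hasDrift_of_driftCoeff_pos hγ hK hodd ?_
    have : driftCoeff γ m (2 * (1 - γ)) = 4 * (1 - γ) * (γ + m) := by
      unfold driftCoeff
      ring
    rw [this]
    exact mul_pos (by linarith) (by linarith)
  have hsmall : γ < -m → HasUpperDrift γ K μ (1 / rho μ γ) ∧ HasLowerDrift γ K μ (1 / rho μ γ) := by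
    intro hmγ
    have hinv : 1 / rho μ γ = 1 - 2 * γ - γ / m := by
      change 1 / (m / ((1 - 2 * γ) * m - γ)) = _
      field_simp
    have hgm : 1 < -γ / m := (one_lt_div hm).2 (by linarith)
    rw [neg_div] at hgm
    -- The second entry is `κ - 2 + 2γ` for `κ = 1 / ρ`, positive exactly because `γ < -m`; the
    -- first keeps `η` below `1 - γ`.
    have hη : 0 < min (1 / 2) (-1 - γ / m) := lt_min (by norm_num) (by linarith)
    have hη1 := min_le_left (1 / 2) (-1 - γ / m)
    have hη2 := min_le_right (1 / 2) (-1 - γ / m)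
    generalize min (1 / 2) (-1 - γ / m) = η at hη hη1 hη2
    have hcoeff : ∀ k, driftCoeff γ m k = 2 * k * m * (k - 1 / rho μ γ) := by
      intro k
      rw [hinv]
      unfold driftCoeff
      field_simp
      ring
    refine hasDrift_of_driftCoeff_eq_zero hγ hK hodd hη (by linarith) (by linarith) ?_ ?_
    · rw [hcoeff, sub_self, mul_zero]
    · rw [hcoeff]
      refine mul_neg_of_pos_of_neg (mul_pos (mul_pos two_pos ?_) hm) (by linarith)
      linarith
  -- The threshold has to be fixed before the case is known, so the regime becomes a hypothesis
  -- inside the existential; in the other regime any value serves.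
  have hex₂ : ∃ A₂ : ℝ, -m < γ → ∀ A, A₂ < A → ∀ x, A < x →
      ∀ (Ω : Type _) [MeasurableSpace Ω] (P : Measure Ω) [IsProbabilityMeasure P]
        (α : ℕ → Ω → ℝ), (∀ k, Measurable (α k)) → (∀ k, P.map (α k) = μ) → iIndepFun α P →
        ∀ ε : ℝ, 0 < ε → ∀ᵐ ω ∂P, ∀ᶠ n : ℕ in atTop,
          maxAbscissa γ K A x (fun k => α k ω) n ≤ (n : ℝ) ^ (1 / (2 * (1 - γ))) *
            Real.log n ^ (1 / (2 * (1 - γ)) + ε) ∧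
          (n : ℝ) ^ (1 / (2 * (1 - γ))) * Real.log n ^ (-(1 / (2 * (1 - γ))) - ε)
              ≤ maxAbscissa γ K A x (fun k => α k ω) n := by
    by_cases h : -m < γ
    · obtain ⟨A₂, h₂⟩ := exists_forall_maxAbscissa_growth hγ hκ (hlarge h).1 (hlarge h).2
      exact ⟨A₂, fun _ => h₂⟩
    · exact ⟨0, fun h' => absurd h' h⟩
  have hex₃ : ∃ A₃ : ℝ, γ < -m → ∀ A, A₃ < A → ∀ x, A < x →
      ∀ (Ω : Type _) [MeasurableSpace Ω] (P : Measure Ω) [IsProbabilityMeasure P]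
        (α : ℕ → Ω → ℝ), (∀ k, Measurable (α k)) → (∀ k, P.map (α k) = μ) → iIndepFun α P →
        ∀ ε : ℝ, 0 < ε → ∀ᵐ ω ∂P, ∀ᶠ n : ℕ in atTop,
          maxAbscissa γ K A x (fun k => α k ω) n ≤ (n : ℝ) ^ rho μ γ *
            Real.log n ^ (rho μ γ + ε) ∧
          (n : ℝ) ^ rho μ γ * Real.log n ^ (-rho μ γ - ε)
              ≤ maxAbscissa γ K A x (fun k => α k ω) n := by
    by_cases h : γ < -m
    · obtain ⟨A₃, h₃⟩ := exists_forall_maxAbscissa_growth hγ (one_div_pos.2 hρ) (hsmall h).1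
        (hsmall h).2
      rw [one_div_one_div] at h₃
      exact ⟨A₃, fun _ => h₃⟩
    · exact ⟨0, fun h' => absurd h' h⟩
  obtain ⟨A₂, h₂⟩ := hex₂
  obtain ⟨A₃, h₃⟩ := hex₃
  refine ⟨max A₁ (max A₂ A₃), fun A hA1 hA p hp hpA Ω _ P _ α hα hlaw hind => ?_⟩
  obtain ⟨hAA₁, hAA₂, hAA₃⟩ : A₁ < A ∧ A₂ < A ∧ A₃ < A := by simpa using hA
  have hA0 : 0 < A := by linarith
  have hpA' : A < p.1 := by linarith
  have hgood : ∀ᵐ ω ∂P, ∀ k, |α k ω| < α₀ := by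
    refine ae_all_iff.2 fun k => ?_
    rw [← hlaw k] at hbdd
    exact ae_of_ae_map (hα k).aemeasurable hbdd
  have hcoll : ∀ᵐ ω ∂P, ∀ k, ∃ σ : ℝ, (σ = 1 ∨ σ = -1) ∧
      collisions (fun x => x ^ γ) A p (fun k => α k ω) k =
        some (abscissa γ K A p.1 (fun k => α k ω) k,
          σ * abscissa γ K A p.1 (fun k => α k ω) k ^ γ) := by
    filter_upwards [hgood] with ω hω k
    exact collisions_eq hγ hA0 (fun x hx => h₁ x (hAA₁.trans hx).le) hp hpA'
      (fun k => abs_tan_le_of_abs_lt hα₀.2 (hω k)) k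
  refine ⟨?_, fun hmγ ε hε => ?_, fun hmγ ε hε => ?_⟩
  · filter_upwards [hcoll] with ω hω n
    obtain ⟨σ, -, hσ⟩ := hω n
    rw [hσ]
    exact Option.some_ne_none _
  · filter_upwards [hcoll, h₂ hmγ A hAA₂ p.1 hpA' Ω P α hα hlaw hind ε hε] with ω hω hg
    simpa only [runningMax_eq hω] using hg
  -- The growth lemma gives logarithmic exponents `±(ρ + ε')`; taking `ε' = ρ + ε` yields the weaker
  -- ones claimed.
  · filter_upwards [hcoll, h₃ hmγ A hAA₃ p.1 hpA' Ω P α hα hlaw hind (rho μ γ + ε)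
      (by linarith)] with ω hω hg
    simp only [runningMax_eq hω]
    rwa [show 2 * rho μ γ + ε = rho μ γ + (rho μ γ + ε) by ring,
      show -(2 * rho μ γ) - ε = -rho μ γ - (rho μ γ + ε) by ring]
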